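/- **Setting.** $\mathcal G(\mathbb R)=\mathcal E_M(\mathbb R)/\mathcal N(\mathbb R)$ is the special Colombeau algebra: $\mathcal E_M(\mathbb R)$ consists of the nets $(u_\varepsilon)_{\varepsilon\in(0,1)}$ in $C^\infty(\mathbb R)$ such that for every compact $K\subset\mathbb R$ and every $k\in\mathbb N_0$ there is $N$ with $\sup_K|u_\varepsilon^{(k)}|=O(\varepsilon^{-N})$ as $\varepsilon\to0$, and $\mathcal N(\mathbb R)$ of those with $\sup_K|u^{(k)}_\varepsilon|=O(\varepsilon^{M})$ for all $K$, $k$ and all $M$. An element of $\mathcal G(\mathbb R)$ is *locally bounded* if it has a representative that is bounded on each compact set, uniformly for small $\varepsilon$; for smooth $g:\mathbb R^2\to\mathbb R$ and locally bounded $x\in\mathcal G(\mathbb R)^2$ the composition $g(x)\in\mathcal G(\mathbb R)$ is the class of $(g(x_\varepsilon))_\varepsilon$. Initial values are understood in the ring of generalized numbers, i.e. up to errors $O(\varepsilon^M)$ for all $M$. For $u\in\mathcal G(\mathbb R)$ and a distribution $w$, $u\approx w$ (association) means $u_\varepsilon-w\to0$ in $\mathcal D'(\mathbb R)$ as $\varepsilon\to0$.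 A *generalized delta function* is an element of $\mathcal G(\mathbb R)$ with a representative $(\rho_\varepsilon)$ such that $\operatorname{supp}\rho_\varepsilon\subseteq[-\varepsilon,\varepsilon]$ for all $\varepsilon\in(0,1)$, $\int\rho_\varepsilon\to1$ as $\varepsilon\to0$, and $\int|\rho_\varepsilon|$ is bounded uniformly for small $\varepsilon$. Let $\theta$ be the Heaviside step function and $u_+=\theta(u)\,u$; indices run over $\{1,2\}$, repeated indices are summed, and a dot denotes $d/du$. **Theorem.** Let $f:\mathbb R^2\to\mathbb R$ be smooth, let $\rho_\varepsilon\in\mathcal G(\mathbb R)$ be a generalized delta function, and let $v_0,\dot v_0\in\mathbb R$, $x_0=(x_0^1,x_0^2)$, $\dot x_0=(\dot x_0^1,\dot x_0^2)\in\mathbb R^2$. The regularized geodesic equation of the impulsive pp-wave $ds^2=f(x)\,\delta(u)\,du^2-du\,dv+(dx^1)^2+(dx^2)^2$, $$\ddot v_\varepsilon=f(x_\varepsilon)\,\dot\rho_\varepsilon+2\,\partial_if(x_\varepsilon)\,\dot x^i_\varepsilon\,\rho_\varepsilon,\qquad \ddot x^i_\varepsilon=\tfrac12\,\partial_if(x_\varepsilon)\,\rho_\varepsilon\quad(i=1,2),$$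 with initial conditions $v_\varepsilon(-1)=v_0$, $\dot v_\varepsilon(-1)=\dot v_0$, $x^i_\varepsilon(-1)=x^i_0$, $\dot x^i_\varepsilon(-1)=\dot x^i_0$, has a unique locally bounded solution $(v_\varepsilon,x^1_\varepsilon,x^2_\varepsilon)\in\mathcal G(\mathbb R)^3$. Moreover, whatever the generalized delta function $\rho_\varepsilon$, $$x^i_\varepsilon\approx x^i_0+\dot x^i_0(1+u)+\tfrac12\,\partial_if(x_0+\dot x_0)\,u_+\qquad(i=1,2),$$ $$v_\varepsilon\approx v_0+\dot v_0(1+u)+f(x_0+\dot x_0)\,\theta(u)+\partial_if(x_0+\dot x_0)\Bigl(\dot x^i_0+\tfrac14\,\partial_if(x_0+\dot x_0)\Bigr)u_+ .$$ -/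

import Mathlib

open Filter Topology MeasureTheory
open scoped ContDiff Distributions

noncomputable section

/-! ## The special Colombeau algebra on the real line -/

/-- The index set `(0,1)` of the regularization parameter `ε`. -/
abbrev Eps : Type := Set.Ioo (0 : ℝ) 1

namespace Colombeau

/-- The filter `ε → 0` on `(0,1)`. -/
def toZero : Filter Eps := comap (fun ε : Eps => (ε : ℝ)) (𝓝 0)

/-- `sup_{t ∈ K} |w_ε(t)| = O(ε^(-N))` for some `N`. -/
def ModerateOn (K : Set ℝ) (w : Eps → ℝ → ℝ) : Prop :=
  ∃ (N : ℕ) (C : ℝ), ∀ᶠ ε in toZero, ∀ t ∈ K, |w ε t| ≤ C * ((ε : ℝ) ^ N)⁻¹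

/-- `sup_{t ∈ K} |w_ε(t)| = O(ε^M)` for all `M`. -/
def NegligibleOn (K : Set ℝ) (w : Eps → ℝ → ℝ) : Prop :=
  ∀ M : ℕ, ∃ C : ℝ, ∀ᶠ ε in toZero, ∀ t ∈ K, |w ε t| ≤ C * (ε : ℝ) ^ M

/-- The nets in `𝓔_M(ℝ)`. -/
structure IsModerate (u : Eps → ℝ → ℝ) : Prop where
  smooth : ∀ ε, ContDiff ℝ ∞ (u ε)
  bound : ∀ K : Set ℝ, IsCompact K → ∀ k : ℕ, ModerateOn K (fun ε => iteratedDeriv k (u ε))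

/-- The estimates defining the nets in `𝓝(ℝ)`. -/
def IsNegligible (u : Eps → ℝ → ℝ) : Prop :=
  ∀ K : Set ℝ, IsCompact K → ∀ k : ℕ, NegligibleOn K (fun ε => iteratedDeriv k (u ε))

/-! ### Stability of the estimates -/

theorem ModerateOn.zero (K : Set ℝ) : ModerateOn K (fun _ _ => 0) :=
  ⟨0, 0, Eventually.of_forall fun _ _ _ => by simp⟩

theorem ModerateOn.const (K : Set ℝ) (c : ℝ) : ModerateOn K (fun _ _ => c) :=
  ⟨0, |c|, Eventually.of_forall fun _ _ _ => by simp⟩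

theorem inv_pow_le_inv_pow (ε : Eps) {N M : ℕ} (h : N ≤ M) :
    ((ε : ℝ) ^ N)⁻¹ ≤ ((ε : ℝ) ^ M)⁻¹ :=
  inv_anti₀ (pow_pos ε.2.1 _) (pow_le_pow_of_le_one ε.2.1.le ε.2.2.le h)

theorem ModerateOn.add {K : Set ℝ} {w z : Eps → ℝ → ℝ} (hw : ModerateOn K w)
    (hz : ModerateOn K z) : ModerateOn K (fun ε t => w ε t + z ε t) := by
  obtain ⟨N, C, h⟩ := hw
  obtain ⟨N', C', h'⟩ := hz
  refine ⟨N + N', |C| + |C'|, ?_⟩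
  filter_upwards [h, h'] with ε h h' t ht
  have e1 := inv_pow_le_inv_pow ε (Nat.le_add_right N N')
  have e2 := inv_pow_le_inv_pow ε (Nat.le_add_left N' N)
  have p1 : 0 ≤ ((ε : ℝ) ^ N)⁻¹ := inv_nonneg.2 (pow_nonneg ε.2.1.le _)
  have p2 : 0 ≤ ((ε : ℝ) ^ N')⁻¹ := inv_nonneg.2 (pow_nonneg ε.2.1.le _)
  calc |w ε t + z ε t| ≤ |w ε t| + |z ε t| := abs_add_le _ _
    _ ≤ C * ((ε : ℝ) ^ N)⁻¹ + C' * ((ε : ℝ) ^ N')⁻¹ := add_le_add (h t ht) (h' t ht)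
    _ ≤ |C| * ((ε : ℝ) ^ N)⁻¹ + |C'| * ((ε : ℝ) ^ N')⁻¹ := by
        gcongr <;> exact le_abs_self _
    _ ≤ |C| * ((ε : ℝ) ^ (N + N'))⁻¹ + |C'| * ((ε : ℝ) ^ (N + N'))⁻¹ := by
        gcongr
    _ = (|C| + |C'|) * ((ε : ℝ) ^ (N + N'))⁻¹ := by ring

theorem ModerateOn.mul {K : Set ℝ} {w z : Eps → ℝ → ℝ} (hw : ModerateOn K w)
    (hz : ModerateOn K z) : ModerateOn K (fun ε t => w ε t * z ε t) := by
  obtain ⟨N, C, h⟩ := hw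
  obtain ⟨N', C', h'⟩ := hz
  refine ⟨N + N', C * C', ?_⟩
  filter_upwards [h, h'] with ε h h' t ht
  calc |w ε t * z ε t| = |w ε t| * |z ε t| := abs_mul _ _
    _ ≤ (C * ((ε : ℝ) ^ N)⁻¹) * (C' * ((ε : ℝ) ^ N')⁻¹) :=
        mul_le_mul (h t ht) (h' t ht) (abs_nonneg _) ((abs_nonneg _).trans (h t ht))
    _ = C * C' * ((ε : ℝ) ^ (N + N'))⁻¹ := by rw [pow_add, mul_inv]; ring

theorem ModerateOn.sum {ι : Type*} {K : Set ℝ} {w : ι → Eps → ℝ → ℝ} (s : Finset ι)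
    (hw : ∀ i ∈ s, ModerateOn K (w i)) : ModerateOn K (fun ε t => ∑ i ∈ s, w i ε t) := by
  classical
  induction s using Finset.induction_on with
  | empty => simpa using ModerateOn.zero K
  | insert a s ha ih =>
    simp only [Finset.sum_insert ha]
    exact (hw a (Finset.mem_insert_self _ _)).add
      (ih fun i hi => hw i (Finset.mem_insert_of_mem hi))

theorem NegligibleOn.zero (K : Set ℝ) : NegligibleOn K (fun _ _ => 0) :=
  fun _ => ⟨0, Eventually.of_forall fun _ _ _ => by simp⟩

theorem NegligibleOn.add {K : Set ℝ} {w z : Eps → ℝ → ℝ} (hw : NegligibleOn K w)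
    (hz : NegligibleOn K z) : NegligibleOn K (fun ε t => w ε t + z ε t) := by
  intro M
  obtain ⟨C, h⟩ := hw M
  obtain ⟨C', h'⟩ := hz M
  refine ⟨C + C', ?_⟩
  filter_upwards [h, h'] with ε h h' t ht
  calc |w ε t + z ε t| ≤ |w ε t| + |z ε t| := abs_add_le _ _
    _ ≤ C * (ε : ℝ) ^ M + C' * (ε : ℝ) ^ M := add_le_add (h t ht) (h' t ht)
    _ = (C + C') * (ε : ℝ) ^ M := by ring

theorem ModerateOn.mul_negligible {K : Set ℝ} {w z : Eps → ℝ → ℝ} (hw : ModerateOn K w)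
    (hz : NegligibleOn K z) : NegligibleOn K (fun ε t => w ε t * z ε t) := by
  intro M
  obtain ⟨N, C, h⟩ := hw
  obtain ⟨C', h'⟩ := hz (N + M)
  refine ⟨C * C', ?_⟩
  filter_upwards [h, h'] with ε h h' t ht
  have hε : (ε : ℝ) ^ N ≠ 0 := (pow_pos ε.2.1 _).ne'
  calc |w ε t * z ε t| = |w ε t| * |z ε t| := abs_mul _ _
    _ ≤ (C * ((ε : ℝ) ^ N)⁻¹) * (C' * (ε : ℝ) ^ (N + M)) :=
        mul_le_mul (h t ht) (h' t ht) (abs_nonneg _) ((abs_nonneg _).trans (h t ht))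
    _ = C * C' * (ε : ℝ) ^ M := by rw [pow_add]; field_simp

theorem NegligibleOn.sum {ι : Type*} {K : Set ℝ} {w : ι → Eps → ℝ → ℝ} (s : Finset ι)
    (hw : ∀ i ∈ s, NegligibleOn K (w i)) : NegligibleOn K (fun ε t => ∑ i ∈ s, w i ε t) := by
  classical
  induction s using Finset.induction_on with
  | empty => simpa using NegligibleOn.zero K
  | insert a s ha ih =>
    simp only [Finset.sum_insert ha]
    exact (hw a (Finset.mem_insert_self _ _)).add
      (ih fun i hi => hw i (Finset.mem_insert_of_mem hi))

theorem smooth_at {u : ℝ → ℝ} (h : ContDiff ℝ ∞ u) (k : ℕ) (t : ℝ) : ContDiffAt ℝ k u t :=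
  (h.of_le (by exact_mod_cast le_top)).contDiffAt

/-- Leibniz' rule, for nets which are moderate up to order `k`. -/
theorem moderateOn_deriv_mul {K : Set ℝ} {u v : Eps → ℝ → ℝ} (k : ℕ)
    (su : ∀ ε, ContDiff ℝ ∞ (u ε)) (sv : ∀ ε, ContDiff ℝ ∞ (v ε))
    (hu : ∀ j ≤ k, ModerateOn K (fun ε => iteratedDeriv j (u ε)))
    (hv : ∀ j ≤ k, ModerateOn K (fun ε => iteratedDeriv j (v ε))) :
    ModerateOn K (fun ε => iteratedDeriv k (fun t => u ε t * v ε t)) := by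
  have : (fun ε => iteratedDeriv k (fun t => u ε t * v ε t)) = fun ε t =>
      ∑ i ∈ Finset.range (k + 1),
        (k.choose i : ℝ) * iteratedDeriv i (u ε) t * iteratedDeriv (k - i) (v ε) t := by
    funext ε t
    exact iteratedDeriv_fun_mul (smooth_at (su ε) k t) (smooth_at (sv ε) k t)
  rw [this]
  refine ModerateOn.sum _ fun i hi => ?_
  exact ((ModerateOn.const K _).mul (hu i (by simpa [Nat.lt_succ_iff] using hi))).mul
    (hv (k - i) (Nat.sub_le _ _))

theorem negligibleOn_deriv_mul {K : Set ℝ} {u v : Eps → ℝ → ℝ} (k : ℕ)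
    (su : ∀ ε, ContDiff ℝ ∞ (u ε)) (sv : ∀ ε, ContDiff ℝ ∞ (v ε))
    (hu : ∀ j ≤ k, ModerateOn K (fun ε => iteratedDeriv j (u ε)))
    (hv : ∀ j ≤ k, NegligibleOn K (fun ε => iteratedDeriv j (v ε))) :
    NegligibleOn K (fun ε => iteratedDeriv k (fun t => u ε t * v ε t)) := by
  have : (fun ε => iteratedDeriv k (fun t => u ε t * v ε t)) = fun ε t =>
      ∑ i ∈ Finset.range (k + 1),
        (k.choose i : ℝ) * iteratedDeriv i (u ε) t * iteratedDeriv (k - i) (v ε) t := by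
    funext ε t
    exact iteratedDeriv_fun_mul (smooth_at (su ε) k t) (smooth_at (sv ε) k t)
  rw [this]
  refine NegligibleOn.sum _ fun i hi => ?_
  exact ((ModerateOn.const K _).mul (hu i (by simpa [Nat.lt_succ_iff] using hi))).mul_negligible
    (hv (k - i) (Nat.sub_le _ _))

theorem IsModerate.const (c : ℝ) : IsModerate (fun _ _ => c) where
  smooth _ := contDiff_const
  bound K _ k := by
    have : (fun _ : Eps => iteratedDeriv k (fun _ : ℝ => c)) =
        fun _ _ => if k = 0 then c else 0 := by
      funext ε t; exact iteratedDeriv_const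
    rw [this]; exact ModerateOn.const K _

theorem IsModerate.add {u v : Eps → ℝ → ℝ} (hu : IsModerate u) (hv : IsModerate v) :
    IsModerate (fun ε t => u ε t + v ε t) where
  smooth ε := (hu.smooth ε).add (hv.smooth ε)
  bound K hK k := by
    have : (fun ε => iteratedDeriv k (fun t => u ε t + v ε t)) = fun ε t =>
        iteratedDeriv k (u ε) t + iteratedDeriv k (v ε) t := by
      funext ε t
      exact iteratedDeriv_fun_add (smooth_at (hu.smooth ε) k t) (smooth_at (hv.smooth ε) k t)
    rw [this]; exact (hu.bound K hK k).add (hv.bound K hK k)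

theorem IsModerate.mul {u v : Eps → ℝ → ℝ} (hu : IsModerate u) (hv : IsModerate v) :
    IsModerate (fun ε t => u ε t * v ε t) where
  smooth ε := (hu.smooth ε).mul (hv.smooth ε)
  bound K hK k := moderateOn_deriv_mul k hu.smooth hv.smooth
    (fun j _ => hu.bound K hK j) (fun j _ => hv.bound K hK j)

theorem IsModerate.deriv {u : Eps → ℝ → ℝ} (hu : IsModerate u) :
    IsModerate (fun ε => deriv (u ε)) where
  smooth ε := (contDiff_infty_iff_deriv.1 (hu.smooth ε)).2
  bound K hK k := by
    have := hu.bound K hK (k + 1)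
    simpa only [iteratedDeriv_succ'] using this

/-- The differential algebra `𝓔_M(ℝ)` of moderate nets, with pointwise operations. -/
def moderateNets : Subalgebra ℝ (Eps → ℝ → ℝ) where
  carrier := {u | IsModerate u}
  mul_mem' := IsModerate.mul
  add_mem' := IsModerate.add
  algebraMap_mem' := IsModerate.const

/-- The ideal `𝓝(ℝ)` of negligible nets in `𝓔_M(ℝ)`. -/
def negligibleNets : Ideal moderateNets where
  carrier := {u | IsNegligible u.1}
  add_mem' := by
    intro u v hu hv K hK k
    have : (fun ε => iteratedDeriv k ((u + v).1 ε)) = fun ε t =>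
        iteratedDeriv k (u.1 ε) t + iteratedDeriv k (v.1 ε) t := by
      funext ε t
      exact iteratedDeriv_fun_add (smooth_at (u.2.smooth ε) k t) (smooth_at (v.2.smooth ε) k t)
    rw [this]; exact (hu K hK k).add (hv K hK k)
  zero_mem' := by
    intro K _ k
    have : (fun ε => iteratedDeriv k ((0 : moderateNets).1 ε)) = fun _ _ => 0 := by
      funext ε t
      exact iteratedDeriv_const_zero
    rw [this]; exact NegligibleOn.zero K
  smul_mem' := by
    intro u v hv K hK k
    exact negligibleOn_deriv_mul k u.2.smooth v.2.smooth
      (fun j _ => u.2.bound K hK j) (fun j _ => hv K hK j)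

end Colombeau

/-- The special Colombeau algebra `𝓖(ℝ) = 𝓔_M(ℝ) / 𝓝(ℝ)`. -/
abbrev ColombeauAlgebra : Type := Colombeau.moderateNets ⧸ Colombeau.negligibleNets

namespace Colombeau

/-- The class of a moderate net in `𝓖(ℝ)`. -/
def mk (U : moderateNets) : ColombeauAlgebra := Ideal.Quotient.mk negligibleNets U

theorem mk_surjective (u : ColombeauAlgebra) : ∃ U, mk U = u :=
  Ideal.Quotient.mk_surjective u

theorem mk_eq_mk {U V : moderateNets} : mk U = mk V ↔ IsNegligible (U - V).1 :=
  Ideal.Quotient.eq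

/-! ### The derivative -/

/-- The derivative of a moderate net. -/
def derivNet (U : moderateNets) : moderateNets := ⟨fun ε => deriv (U.1 ε), IsModerate.deriv U.2⟩

theorem derivNet_sub_negligible {U V : moderateNets} (h : IsNegligible (U - V).1) :
    IsNegligible (derivNet U - derivNet V).1 := by
  intro K hK k
  have e : ∀ ε, (derivNet U - derivNet V).1 ε = deriv ((U - V).1 ε) := by
    intro ε
    funext t
    exact (deriv_sub ((U.2.smooth ε).differentiable (by simp) t)
      ((V.2.smooth ε).differentiable (by simp) t)).symm
  simpa only [e, iteratedDeriv_succ'] using h K hK (k + 1)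

/-- The derivative `u ↦ u̇` on `𝓖(ℝ)`, acting on representatives. -/
def D (u : ColombeauAlgebra) : ColombeauAlgebra :=
  Quotient.liftOn' u (fun U => mk (derivNet U)) fun U V h =>
    mk_eq_mk.2 (derivNet_sub_negligible (mk_eq_mk.1 (Quotient.sound' h : mk U = mk V)))

theorem D_mk (U : moderateNets) : D (mk U) = mk (derivNet U) := rfl

/-! ### Locally bounded generalized functions and composition with smooth functions -/

/-- The net is bounded on every compact set, uniformly for small `ε`. -/
def NetLocallyBounded (u : Eps → ℝ → ℝ) : Prop :=
  ∀ K : Set ℝ, IsCompact K → ∃ C : ℝ, ∀ᶠ ε in toZero, ∀ t ∈ K, |u ε t| ≤ C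

/-- A generalized function is locally bounded if it has a locally bounded representative. -/
def LocallyBounded (u : ColombeauAlgebra) : Prop :=
  ∃ U : moderateNets, mk U = u ∧ NetLocallyBounded U.1

/-- `∂_i f`. -/
def partialDeriv {n : ℕ} (i : Fin n) (f : (Fin n → ℝ) → ℝ) : (Fin n → ℝ) → ℝ :=
  fun p => fderiv ℝ f p (Pi.single i 1)

theorem contDiff_partialDeriv {n : ℕ} {f : (Fin n → ℝ) → ℝ} (hf : ContDiff ℝ ∞ f) (i : Fin n) :
    ContDiff ℝ ∞ (partialDeriv i f) :=
  (hf.fderiv_right (m := ∞) (by simp)).clm_apply contDiff_const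

theorem contDiff_comp_net {n : ℕ} {f : (Fin n → ℝ) → ℝ} (hf : ContDiff ℝ ∞ f)
    {X : Fin n → Eps → ℝ → ℝ} (hX : ∀ i, IsModerate (X i)) (ε : Eps) :
    ContDiff ℝ ∞ (fun t => f fun i => X i ε t) :=
  hf.comp (contDiff_pi.2 fun i => (hX i).smooth ε)

/-- Chain rule for `f(x_ε)`. -/
theorem deriv_comp_net {n : ℕ} {f : (Fin n → ℝ) → ℝ} (hf : ContDiff ℝ ∞ f)
    {X : Fin n → Eps → ℝ → ℝ} (hX : ∀ i, IsModerate (X i)) (ε : Eps) :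
    deriv (fun t => f fun i => X i ε t) =
      fun t => ∑ i, partialDeriv i f (fun i => X i ε t) * deriv (X i ε) t := by
  funext t
  have h1 : HasFDerivAt f (fderiv ℝ f fun i => X i ε t) (fun i => X i ε t) :=
    (hf.differentiable (by simp) _).hasFDerivAt
  have h2 : HasDerivAt (fun t => fun i => X i ε t) (fun i => deriv (X i ε) t) t :=
    hasDerivAt_pi.2 fun i => (((hX i).smooth ε).differentiable (by simp) t).hasDerivAt
  have h3 : HasDerivAt (fun t => f fun i => X i ε t)
      (fderiv ℝ f (fun i => X i ε t) fun i => deriv (X i ε) t) t := h1.comp_hasDerivAt t h2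
  rw [h3.deriv, pi_eq_sum_univ' (fun i => deriv (X i ε) t), map_sum]
  refine Finset.sum_congr rfl fun i _ => ?_
  rw [map_smul, smul_eq_mul, mul_comm]
  rfl

theorem exists_common_bound {n : ℕ} {X : Fin n → Eps → ℝ → ℝ}
    (bX : ∀ i, NetLocallyBounded (X i)) {K : Set ℝ} (hK : IsCompact K) :
    ∃ R : ℝ, ∀ᶠ ε in toZero, ∀ t ∈ K, (fun i => X i ε t) ∈ Metric.closedBall (0 : Fin n → ℝ) R := by
  choose C hC using fun i => bX i K hK
  refine ⟨∑ i, |C i|, ?_⟩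
  filter_upwards [eventually_all.2 hC] with ε h t ht
  rw [mem_closedBall_zero_iff, pi_norm_le_iff_of_nonneg (Finset.sum_nonneg fun i _ => abs_nonneg _)]
  intro i
  exact ((h i t ht).trans (le_abs_self _)).trans
    (Finset.single_le_sum (f := fun i => |C i|) (fun i _ => abs_nonneg _) (Finset.mem_univ i))

theorem moderateOn_comp {n : ℕ} {X : Fin n → Eps → ℝ → ℝ}
    (hX : ∀ i, IsModerate (X i)) (bX : ∀ i, NetLocallyBounded (X i))
    {K : Set ℝ} (hK : IsCompact K) (k : ℕ) :
    ∀ f : (Fin n → ℝ) → ℝ, ContDiff ℝ ∞ f →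
      ModerateOn K (fun ε => iteratedDeriv k (fun t => f fun i => X i ε t)) := by
  induction k using Nat.strong_induction_on with
  | _ k ih =>
  intro f hf
  cases k with
  | zero =>
    obtain ⟨R, hR⟩ := exists_common_bound bX hK
    obtain ⟨C, hC⟩ := (isCompact_closedBall (0 : Fin n → ℝ) R).exists_bound_of_continuousOn
      hf.continuous.continuousOn
    refine ⟨0, C, ?_⟩
    filter_upwards [hR] with ε h t ht
    simpa using hC _ (h t ht)
  | succ k =>
    have e : (fun ε => iteratedDeriv (k + 1) (fun t => f fun i => X i ε t)) = fun ε t =>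
        ∑ i, iteratedDeriv k
          (fun t => partialDeriv i f (fun i => X i ε t) * deriv (X i ε) t) t := by
      funext ε t
      rw [iteratedDeriv_succ', deriv_comp_net hf hX ε]
      exact iteratedDeriv_fun_sum fun i _ => smooth_at
        ((contDiff_comp_net (contDiff_partialDeriv hf i) hX ε).mul ((hX i).deriv.smooth ε)) k t
    rw [e]
    refine ModerateOn.sum _ fun i _ => ?_
    exact moderateOn_deriv_mul k (contDiff_comp_net (contDiff_partialDeriv hf i) hX)
      (hX i).deriv.smooth
      (fun j hj => ih j (Nat.lt_succ_of_le hj) _ (contDiff_partialDeriv hf i))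
      (fun j _ => (hX i).deriv.bound K hK j)

theorem negligibleOn_comp {n : ℕ} {X Y : Fin n → moderateNets}
    (bX : ∀ i, NetLocallyBounded (X i).1) (bY : ∀ i, NetLocallyBounded (Y i).1)
    (hXY : ∀ i, mk (X i) = mk (Y i)) {K : Set ℝ} (hK : IsCompact K) (k : ℕ) :
    ∀ f : (Fin n → ℝ) → ℝ, ContDiff ℝ ∞ f →
      NegligibleOn K (fun ε => iteratedDeriv k
        (fun t => f (fun i => (X i).1 ε t) - f (fun i => (Y i).1 ε t))) := by
  have mX : ∀ i, IsModerate (X i).1 := fun i => (X i).2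
  have mY : ∀ i, IsModerate (Y i).1 := fun i => (Y i).2
  induction k using Nat.strong_induction_on with
  | _ k ih =>
  intro f hf
  cases k with
  | zero =>
    obtain ⟨R, hR⟩ := exists_common_bound bX hK
    obtain ⟨R', hR'⟩ := exists_common_bound bY hK
    obtain ⟨L, hL⟩ := ((hf.of_le (by simp) : ContDiff ℝ 1 f).locallyLipschitz.locallyLipschitzOn
      (s := Metric.closedBall 0 (max R R'))).exists_lipschitzOnWith_of_compact
        (isCompact_closedBall _ _)
    intro M
    choose C hC using fun i => mk_eq_mk.1 (hXY i) K hK 0 M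
    refine ⟨L * ∑ i, |C i|, ?_⟩
    filter_upwards [hR, hR', eventually_all.2 hC] with ε h h' hd t ht
    have hp := hL.norm_sub_le (Metric.closedBall_subset_closedBall (le_max_left R R') (h t ht))
      (Metric.closedBall_subset_closedBall (le_max_right R R') (h' t ht))
    have hε : 0 ≤ (ε : ℝ) ^ M := pow_nonneg ε.2.1.le _
    simp only [iteratedDeriv_zero]
    refine hp.trans ?_
    rw [mul_assoc]
    refine mul_le_mul_of_nonneg_left ?_ L.2
    rw [pi_norm_le_iff_of_nonneg
      (mul_nonneg (Finset.sum_nonneg fun i _ => abs_nonneg _) hε)]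
    intro i
    have := hd i t ht
    simp only [iteratedDeriv_zero] at this
    refine le_trans this (mul_le_mul_of_nonneg_right ?_ hε)
    exact (le_abs_self _).trans
      (Finset.single_le_sum (f := fun i => |C i|) (fun i _ => abs_nonneg _) (Finset.mem_univ i))
  | succ k =>
    have s1 : ∀ i ε, ContDiff ℝ ∞ (fun t => deriv ((X i).1 ε) t *
        (partialDeriv i f (fun i => (X i).1 ε t) - partialDeriv i f (fun i => (Y i).1 ε t))) :=
      fun i ε => ((mX i).deriv.smooth ε).mul
        ((contDiff_comp_net (contDiff_partialDeriv hf i) mX ε).sub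
          (contDiff_comp_net (contDiff_partialDeriv hf i) mY ε))
    have s2 : ∀ i ε, ContDiff ℝ ∞ (fun t => partialDeriv i f (fun i => (Y i).1 ε t) *
        (derivNet (X i) - derivNet (Y i)).1 ε t) :=
      fun i ε => (contDiff_comp_net (contDiff_partialDeriv hf i) mY ε).mul
        ((derivNet (X i) - derivNet (Y i)).2.smooth ε)
    have e : (fun ε => iteratedDeriv (k + 1)
        (fun t => f (fun i => (X i).1 ε t) - f (fun i => (Y i).1 ε t))) = fun ε t =>
        ∑ i, (iteratedDeriv k (fun t => deriv ((X i).1 ε) t *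
            (partialDeriv i f (fun i => (X i).1 ε t) -
              partialDeriv i f (fun i => (Y i).1 ε t))) t +
          iteratedDeriv k (fun t => partialDeriv i f (fun i => (Y i).1 ε t) *
            (derivNet (X i) - derivNet (Y i)).1 ε t) t) := by
      funext ε t
      have d : deriv (fun t => f (fun i => (X i).1 ε t) - f (fun i => (Y i).1 ε t)) =
          fun t => ∑ i, (deriv ((X i).1 ε) t * (partialDeriv i f (fun i => (X i).1 ε t) -
              partialDeriv i f (fun i => (Y i).1 ε t)) +
            partialDeriv i f (fun i => (Y i).1 ε t) *
              (derivNet (X i) - derivNet (Y i)).1 ε t) := by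
        funext t
        rw [deriv_fun_sub ((contDiff_comp_net hf mX ε).differentiable (by simp) t)
          ((contDiff_comp_net hf mY ε).differentiable (by simp) t),
          deriv_comp_net hf mX ε, deriv_comp_net hf mY ε, ← Finset.sum_sub_distrib]
        refine Finset.sum_congr rfl fun i _ => ?_
        have : (derivNet (X i) - derivNet (Y i)).1 ε t =
          deriv ((X i).1 ε) t - deriv ((Y i).1 ε) t := rfl
        rw [this]; ring
      rw [iteratedDeriv_succ', d, iteratedDeriv_fun_sum fun i _ =>
        smooth_at ((s1 i ε).add (s2 i ε)) k t]
      exact Finset.sum_congr rfl fun i _ =>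
        iteratedDeriv_fun_add (smooth_at (s1 i ε) k t) (smooth_at (s2 i ε) k t)
    rw [e]
    refine NegligibleOn.sum _ fun i _ => NegligibleOn.add ?_ ?_
    · exact negligibleOn_deriv_mul k (mX i).deriv.smooth
        (fun ε => (contDiff_comp_net (contDiff_partialDeriv hf i) mX ε).sub
          (contDiff_comp_net (contDiff_partialDeriv hf i) mY ε))
        (fun j _ => (mX i).deriv.bound K hK j)
        (fun j hj => ih j (Nat.lt_succ_of_le hj) _ (contDiff_partialDeriv hf i))
    · exact negligibleOn_deriv_mul k (contDiff_comp_net (contDiff_partialDeriv hf i) mY)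
        (derivNet (X i) - derivNet (Y i)).2.smooth
        (fun j _ => moderateOn_comp mY bY hK j _ (contDiff_partialDeriv hf i))
        (fun j _ => derivNet_sub_negligible (mk_eq_mk.1 (hXY i)) K hK j)

/-- The net `f(x_ε)`, for `f` smooth and `x_ε` moderate and locally bounded. -/
def compNet {n : ℕ} (f : (Fin n → ℝ) → ℝ) (hf : ContDiff ℝ ∞ f) (X : Fin n → moderateNets)
    (bX : ∀ i, NetLocallyBounded (X i).1) : moderateNets :=
  ⟨fun ε t => f fun i => (X i).1 ε t,
    ⟨contDiff_comp_net hf fun i => (X i).2,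
      fun _ hK k => moderateOn_comp (fun i => (X i).2) bX hK k f hf⟩⟩

/-- The composition `f(x) ∈ 𝓖(ℝ)` of a smooth function `f` on `ℝⁿ` with a locally bounded
`x ∈ 𝓖(ℝ)ⁿ`, formed on locally bounded representatives; by `comp_eq_mk` the choice of the
representatives is immaterial. -/
def comp {n : ℕ} (f : (Fin n → ℝ) → ℝ) (hf : ContDiff ℝ ∞ f) (x : Fin n → ColombeauAlgebra)
    (hx : ∀ i, LocallyBounded (x i)) : ColombeauAlgebra :=
  mk (compNet f hf (fun i => (hx i).choose) fun i => (hx i).choose_spec.2)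

theorem comp_eq_mk {n : ℕ} {f : (Fin n → ℝ) → ℝ} (hf : ContDiff ℝ ∞ f)
    {x : Fin n → ColombeauAlgebra} (hx : ∀ i, LocallyBounded (x i)) (X : Fin n → moderateNets)
    (bX : ∀ i, NetLocallyBounded (X i).1) (hX : ∀ i, mk (X i) = x i) :
    comp f hf x hx = mk (compNet f hf X bX) :=
  mk_eq_mk.2 fun _ hK k => negligibleOn_comp (fun i => (hx i).choose_spec.2) bX
    (fun i => (hx i).choose_spec.1.trans (hX i).symm) hK k f hf

/-! ### Point values, association, generalized delta functions -/

/-- `u(t) = c` in the ring of generalized numbers: `u_ε(t) - c = O(ε^M)` for all `M`. -/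
def HasValueAt (u : ColombeauAlgebra) (t c : ℝ) : Prop :=
  ∀ U : moderateNets, mk U = u → ∀ M : ℕ, ∃ C : ℝ, ∀ᶠ ε in toZero, |U.1 ε t - c| ≤ C * (ε : ℝ) ^ M

/-- `u ≈ w` for `u ∈ 𝓖(ℝ)` and the distribution given by a locally integrable function `w`:
the difference `u_ε - w` converges to `0` in `𝓓'(ℝ)` as `ε → 0`. -/
def Associated (u : ColombeauAlgebra) (w : ℝ → ℝ) : Prop :=
  LocallyIntegrable w ∧ ∀ U : moderateNets, mk U = u → ∀ φ : 𝓓((⊤ : TopologicalSpace.Opens ℝ), ℝ),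
    Tendsto (fun ε : Eps => ∫ t, (U.1 ε t - w t) * φ t) toZero (𝓝 0)

/-- A generalized delta function: an element of `𝓖(ℝ)` given by a net `ρ_ε` with support in
`[-ε, ε]`, integral tending to `1`, and `L¹` norm bounded uniformly for small `ε`. -/
def IsGeneralizedDelta (ρ : ColombeauAlgebra) : Prop :=
  ∃ R : moderateNets, mk R = ρ ∧
    (∀ ε : Eps, tsupport (R.1 ε) ⊆ Set.Icc (-(ε : ℝ)) ε) ∧
    Tendsto (fun ε : Eps => ∫ t, R.1 ε t) toZero (𝓝 1) ∧
    ∃ C : ℝ, ∀ᶠ ε in toZero, ∫ t, |R.1 ε t| ≤ C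

end Colombeau

/-! ## The regularized geodesic equation of an impulsive pp-wave -/

open Colombeau

/-- `(v, x)` is a locally bounded solution in `𝓖(ℝ)³` of the regularized geodesic equation
with profile function `f`, regularization `ρ` of the delta function, and initial values
`v₀, v₁` (for `v, v̇`) and `x₀, x₁` (for `x, ẋ`) at `u = -1`. -/
structure IsLocallyBoundedGeodesic (f : (Fin 2 → ℝ) → ℝ) (hf : ContDiff ℝ ∞ f)
    (ρ : ColombeauAlgebra) (v₀ v₁ : ℝ) (x₀ x₁ : Fin 2 → ℝ)
    (v : ColombeauAlgebra) (x : Fin 2 → ColombeauAlgebra) : Prop where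
  v_bdd : LocallyBounded v
  x_bdd : ∀ i, LocallyBounded (x i)
  v_eq : D (D v) = comp f hf x x_bdd * D ρ +
    2 * ∑ i, comp (partialDeriv i f) (contDiff_partialDeriv hf i) x x_bdd * D (x i) * ρ
  x_eq : ∀ i, D (D (x i)) =
    (1 / 2 : ℝ) • (comp (partialDeriv i f) (contDiff_partialDeriv hf i) x x_bdd * ρ)
  v_init : HasValueAt v (-1) v₀
  v_init' : HasValueAt (D v) (-1) v₁
  x_init : ∀ i, HasValueAt (x i) (-1) (x₀ i)
  x_init' : ∀ i, HasValueAt (D (x i)) (-1) (x₁ i)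

/-- The step function `θ`. -/
def heaviside (u : ℝ) : ℝ := if 0 < u then 1 else 0

/-- The kink function `u₊ = θ(u) u`. -/
def kink (u : ℝ) : ℝ := heaviside u * u

end

/-! The weight `ρ_ε` lives on `[-ε, ε]` and has bounded `L¹` norm, so it changes the velocity by a
bounded amount while the position moves only `O(ε)` across its support. The nonlinearity is
therefore evaluated only near `x₀ + x₁`, the point where the free straight line meets the shock, and
everything else follows from this. Existence: replace the right hand side by a compactly supported,
hence bounded and globally Lipschitz, function `G` that agrees with it on the unit ball about `x₀ +
x₁`. On `[-ε, ε]` the integral operator contracts with constant `2εLC` (`exists_solution`), and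
outside the support the motion is free. The solution enters the support within `O(ε)` of `x₀ + x₁`
and stays there, so for small `ε` the cutoff is invisible (`exists_solution_net`). Positions and
velocities are bounded, and higher derivatives are moderate by the equation itself. The component
`v` is then explicit: the equation integrates once to `v̇ = v₁ + ρ f(x) + ∑ ((ẋⁱ)² - (x₁ⁱ)²)`,
because `∂ᵢf(x) ρ = 2ẍⁱ`. Uniqueness: the difference of two locally bounded solutions satisfies a
linear inequality with weight `L|ρ_ε|` and a negligible error. A Gronwall factor is avoided by
absorbing the maximum over the support, whose coefficient is `O(ε)` (`norm_le_of_delta_driven`).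
This yields estimates of order zero; interpolation with moderateness gives all derivatives
(`isNegligible_of_order_zero`). Association: integrating the equations, `ρ_ε g(x_ε)` contributes
`g(x₀ + x₁) θ` in the limit for continuous `g`, so `ẋ` acquires a jump, `x` a kink, and `v` both.
Pointwise convergence off the origin and local bounds give convergence in `𝓓'` by dominated
convergence; uniqueness transfers the limits to every solution. -/

namespace Colombeau

/-! ### Calculus on the line -/

/-- Interpolation of a derivative between the function and its second derivative. -/
theorem abs_deriv_le_of_abs_le {u : ℝ → ℝ} (hu : ContDiff ℝ ∞ u) {t h A B : ℝ} (hh : 0 < h)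
    (hA : ∀ s ∈ Set.Icc t (t + h), |u s| ≤ A)
    (hB : ∀ s ∈ Set.Icc t (t + h), |deriv (deriv u) s| ≤ B) :
    |deriv u t| ≤ 2 * A / h + B * h := by
  have d0 := hu.differentiable (by simp)
  have hu' := (contDiff_infty_iff_deriv.1 hu).2
  have d1 := hu'.differentiable (by simp)
  have mt : t ∈ Set.Icc t (t + h) := ⟨le_rfl, by linarith⟩
  have mth : t + h ∈ Set.Icc t (t + h) := ⟨by linarith, le_rfl⟩
  have hB0 : 0 ≤ B := (abs_nonneg _).trans (hB t mt)
  have e1 : ∀ s ∈ Set.Icc t (t + h), ‖deriv u s - deriv u t‖ ≤ B * h := fun s hs => by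
    refine ((convex_Icc t (t + h)).norm_image_sub_le_of_norm_deriv_le
      (fun x _ => d1 x) hB mt hs).trans ?_
    refine mul_le_mul_of_nonneg_left ?_ hB0
    rw [Real.norm_eq_abs, abs_le]; constructor <;> linarith [hs.1, hs.2]
  have e2 := (convex_Icc t (t + h)).norm_image_sub_le_of_norm_hasDerivWithin_le
    (f := fun s => u s - s * deriv u t) (f' := fun s => deriv u s - 1 * deriv u t)
    (fun x _ => ((d0 x).hasDerivAt.sub ((hasDerivAt_id x).mul_const _)).hasDerivWithinAt)
    (fun s hs => by simpa using e1 s hs) mt mth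
  have e3 : |u (t + h) - u t - h * deriv u t| ≤ B * h * h := by
    have : u (t + h) - (t + h) * deriv u t - (u t - t * deriv u t) =
      u (t + h) - u t - h * deriv u t := by ring
    rw [this] at e2
    simpa [abs_of_pos hh] using e2
  have a1 := hA t mt
  have a2 := hA _ mth
  have e4 : |h * deriv u t| ≤ 2 * A + B * h * h := by
    rw [abs_le] at *
    constructor <;> linarith [a1.1, a1.2, a2.1, a2.2, e3.1, e3.2]
  rw [abs_mul, abs_of_pos hh] at e4
  have : |deriv u t| ≤ (2 * A + B * h * h) / h := by
    rw [le_div_iff₀ hh]; linarith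
  refine this.trans (le_of_eq ?_)
  field_simp

theorem integral_sub_of_hasDerivAt {E : Type*} [NormedAddCommGroup E] [NormedSpace ℝ E]
    [CompleteSpace E] {w w' : ℝ → E} (h : ∀ t, HasDerivAt w (w' t) t) (hc : Continuous w')
    (a b : ℝ) : ∫ s in a..b, w' s = w b - w a :=
  intervalIntegral.integral_eq_sub_of_hasDerivAt (fun t _ => h t) (hc.intervalIntegrable _ _)

/-- The `L¹` norm of a continuous function with compact support bounds interval integrals. -/
theorem integral_abs_interval_le {r : ℝ → ℝ} (hr : Continuous r) {ε C : ℝ}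
    (hs : ∀ t, t ∉ Set.Icc (-ε) ε → r t = 0) (hC : ∫ t, |r t| ≤ C) {a b : ℝ} (hab : a ≤ b) :
    ∫ t in a..b, |r t| ≤ C := by
  have hcs : HasCompactSupport (fun t => |r t|) :=
    HasCompactSupport.intro (isCompact_Icc (a := -ε) (b := ε)) fun t ht => by simp [hs t ht]
  rw [intervalIntegral.integral_of_le hab]
  exact (setIntegral_le_integral (hr.abs.integrable_of_hasCompactSupport hcs)
    (Eventually.of_forall fun t => abs_nonneg _)).trans hC

/-- A mean value estimate with an `L¹` weight: a derivative as large as `1/ε` on the support still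
produces a bounded increment. All bounds uniform in `ε` for velocities and for `v` come from here.
-/
theorem norm_sub_le_of_norm_deriv_le {E : Type*} [NormedAddCommGroup E] [NormedSpace ℝ E]
    [CompleteSpace E] {w w' : ℝ → E} (h : ∀ t, HasDerivAt w (w' t) t) (hc : Continuous w')
    {r : ℝ → ℝ} (hr : Continuous r) {ε C : ℝ}
    (hs : ∀ t, t ∉ Set.Icc (-ε) ε → r t = 0) (hC : ∫ t, |r t| ≤ C) {S δ : ℝ} (hS : 0 ≤ S)
    {a b : ℝ} (hab : a ≤ b) (hw : ∀ t ∈ Set.Icc a b, ‖w' t‖ ≤ S * |r t| + δ) :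
    ‖w b - w a‖ ≤ S * C + δ * (b - a) := by
  rw [← integral_sub_of_hasDerivAt h hc]
  have hi : IntervalIntegrable (fun t => S * |r t|) volume a b :=
    (continuous_const.mul hr.abs).intervalIntegrable _ _
  refine (intervalIntegral.norm_integral_le_of_norm_le hab (g := fun t => S * |r t| + δ)
    (Eventually.of_forall fun t ht => hw t ⟨ht.1.le, ht.2⟩)
    (hi.add intervalIntegrable_const)).trans ?_
  rw [intervalIntegral.integral_add hi intervalIntegrable_const,
    intervalIntegral.integral_const_mul, intervalIntegral.integral_const, smul_eq_mul,
    mul_comm (b - a)]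
  gcongr
  exact integral_abs_interval_le hr hs hC hab

/-- Stability of second order equations driven by an `L¹` bounded strict delta net: the weight
`r` is concentrated on such a short interval that no exponential growth occurs. -/
theorem norm_le_of_delta_driven {E : Type*} [NormedAddCommGroup E] [NormedSpace ℝ E]
    [CompleteSpace E] {w w' w'' : ℝ → E} (h : ∀ t, HasDerivAt w (w' t) t)
    (h' : ∀ t, HasDerivAt w' (w'' t) t) (hc : Continuous w'')
    {r : ℝ → ℝ} (hr : Continuous r) {ε L C δ T : ℝ} (hε : 0 < ε) (hε1 : ε < 1)
    (hs : ∀ t, t ∉ Set.Icc (-ε) ε → r t = 0) (hC : ∫ t, |r t| ≤ C) (hL : 0 ≤ L) (hT : 1 ≤ T)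
    (hsmall : 4 * ε * L * C ≤ 1) (h0 : ‖w (-1)‖ ≤ δ) (h1 : ‖w' (-1)‖ ≤ δ)
    (hw : ∀ t ∈ Set.Icc (-T) T, ‖w'' t‖ ≤ L * |r t| * ‖w t‖ + δ) :
    ∀ t ∈ Set.Icc (-T) T,
      ‖w t‖ ≤ (1 + (T + 1) * (L * C * (2 * (4 + 2 * (2 * T + 1))) + (2 * T + 1))) * δ := by
  have hδ : 0 ≤ δ := (norm_nonneg _).trans h0
  have hC0 : 0 ≤ C := (integral_nonneg fun t => abs_nonneg (r t)).trans hC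
  have wc : Continuous w := continuous_iff_continuousAt.2 fun t => (h t).continuousAt
  have wc' : Continuous w' := continuous_iff_continuousAt.2 fun t => (h' t).continuousAt
  -- Only values of `w` on the support of `r` enter the weighted term, so its maximum `S` there
  -- controls the whole inequality.
  obtain ⟨t₀, ht₀, hmax⟩ := (isCompact_Icc (a := -ε) (b := ε)).exists_isMaxOn
    ⟨0, by constructor <;> linarith⟩ wc.norm.continuousOn
  set S := ‖w t₀‖ with hS
  have hS0 : 0 ≤ S := norm_nonneg _
  have hw2 : ∀ t ∈ Set.Icc (-T) T, ‖w'' t‖ ≤ (L * S) * |r t| + δ := fun t ht => by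
    refine (hw t ht).trans ?_
    by_cases hm : t ∈ Set.Icc (-ε) ε
    · have : ‖w t‖ ≤ S := hmax hm
      have : L * |r t| * ‖w t‖ ≤ L * |r t| * S := by gcongr
      linarith
    · simp [hs t hm]
  have hLS : 0 ≤ L * S := mul_nonneg hL hS0
  -- `a` will bound `w'`: total impulse `L S C`, drift `2Tδ` (as `|t + 1| ≤ 2T` for `T ≥ 1`), and
  -- initial value `δ`.
  set a := L * S * C + (2 * T + 1) * δ with ha
  have ha0 : 0 ≤ a := by positivity
  have m1 : (-1 : ℝ) ∈ Set.Icc (-T) T := ⟨by linarith, by linarith⟩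
  have w1 : ∀ t ∈ Set.Icc (-T) T, ‖w' t‖ ≤ a := fun t ht => by
    have key : ‖w' t - w' (-1)‖ ≤ L * S * C + δ * (2 * T) := by
      rcases le_total (-1) t with h | h
      · refine (norm_sub_le_of_norm_deriv_le h' hc hr hs hC hLS h fun s hs =>
          hw2 s ⟨m1.1.trans hs.1, hs.2.trans ht.2⟩).trans ?_
        gcongr; linarith [ht.2]
      · rw [norm_sub_rev]
        refine (norm_sub_le_of_norm_deriv_le h' hc hr hs hC hLS h fun s hs =>
          hw2 s ⟨ht.1.trans hs.1, hs.2.trans m1.2⟩).trans ?_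
        gcongr; linarith [ht.1]
    calc ‖w' t‖ = ‖(w' t - w' (-1)) + w' (-1)‖ := by simp
      _ ≤ _ := norm_add_le _ _
      _ ≤ _ := add_le_add key h1
      _ = a := by rw [ha]; ring
  have wT : ∀ s ∈ Set.Icc (-T) T, ∀ t ∈ Set.Icc (-T) T, ‖w t - w s‖ ≤ a * |t - s| :=
    fun s hs t ht => (convex_Icc (-T) T).norm_image_sub_le_of_norm_hasDerivWithin_le
      (fun x _ => (h x).hasDerivWithinAt) w1 hs ht
  have wl : ∀ t ∈ Set.Icc (-1) (-ε), ‖w' t‖ ≤ 2 * δ := fun t ht => by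
    have : ‖w' t - w' (-1)‖ ≤ δ * ‖t - (-1)‖ := by
      refine (convex_Icc (-1) (-ε)).norm_image_sub_le_of_norm_hasDerivWithin_le
        (fun x _ => (h' x).hasDerivWithinAt) (fun x hx => ?_) ⟨le_rfl, by linarith⟩ ht
      -- At `-ε` itself the support hypothesis says nothing; the bound there follows by continuity
      -- from the open interval.
      have hcx : Set.Icc (-1) (-ε) ⊆ closure (Set.Ioo (-1) (-ε)) := by
        rw [closure_Ioo (by linarith)]
      refine closure_minimal (s := Set.Ioo (-1) (-ε)) (t := {x | ‖w'' x‖ ≤ δ}) (fun y hy => ?_)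
        (isClosed_le hc.norm continuous_const) (hcx hx)
      have := hw y ⟨by linarith [hy.1], by linarith [hy.2]⟩
      rw [hs y fun hm => by linarith [hm.1, hy.2]] at this
      simpa using this
    have h2 : ‖t - (-1)‖ ≤ 1 := by
      rw [Real.norm_eq_abs, abs_le]; constructor <;> linarith [ht.1, ht.2]
    calc ‖w' t‖ = ‖(w' t - w' (-1)) + w' (-1)‖ := by simp
      _ ≤ _ := norm_add_le _ _
      _ ≤ δ * 1 + δ := add_le_add (this.trans (by gcongr)) h1
      _ = 2 * δ := by ring
  have wε : ‖w (-ε)‖ ≤ 3 * δ := by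
    have := (convex_Icc (-1) (-ε)).norm_image_sub_le_of_norm_hasDerivWithin_le
      (fun x _ => (h x).hasDerivWithinAt) wl (x := -1) (y := -ε) ⟨le_rfl, by linarith⟩
      ⟨by linarith, le_rfl⟩
    have h2 : ‖-ε - (-1)‖ ≤ 1 := by
      rw [Real.norm_eq_abs, abs_le]; constructor <;> linarith
    calc ‖w (-ε)‖ = ‖(w (-ε) - w (-1)) + w (-1)‖ := by simp
      _ ≤ _ := norm_add_le _ _
      _ ≤ 2 * δ * 1 + δ := add_le_add (this.trans (by gcongr)) h0
      _ = 3 * δ := by ring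
  -- Absorption: `t₀` is at most `2ε` away from `-ε`, where `w` is still `O(δ)`, so `S ≤ 2εa + 3δ`.
  -- The part of `2εa` containing `S` is at most `S / 2` by `hsmall` and moves to the left.
  have Sle : S ≤ 2 * (4 + 2 * (2 * T + 1)) * δ := by
    have e := wT (-ε) ⟨by linarith, by linarith⟩ t₀ ⟨by linarith [ht₀.1], by linarith [ht₀.2]⟩
    have e2 : |t₀ - -ε| ≤ 2 * ε := by
      rw [abs_le]; constructor <;> linarith [ht₀.1, ht₀.2]
    have e3 : S ≤ a * (2 * ε) + 3 * δ := by
      calc S = ‖(w t₀ - w (-ε)) + w (-ε)‖ := by simp [hS]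
        _ ≤ _ := norm_add_le _ _
        _ ≤ _ := add_le_add (e.trans (by gcongr)) wε
    have e4 : a * (2 * ε) = (4 * ε * L * C) * S / 2 + 2 * (2 * T + 1) * δ * ε := by
      rw [ha]; ring
    have e5 : (4 * ε * L * C) * S ≤ 1 * S := by gcongr
    have e6 : 2 * (2 * T + 1) * δ * ε ≤ 2 * (2 * T + 1) * δ * 1 := by gcongr
    linarith
  intro t ht
  have e := wT (-1) m1 t ht
  have e2 : |t - -1| ≤ T + 1 := by
    rw [abs_le]; constructor <;> linarith [ht.1, ht.2]
  have e3 : a ≤ (L * C * (2 * (4 + 2 * (2 * T + 1))) + (2 * T + 1)) * δ := by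
    have : L * C * S ≤ L * C * (2 * (4 + 2 * (2 * T + 1)) * δ) := by gcongr
    rw [ha]; linarith
  calc ‖w t‖ = ‖(w t - w (-1)) + w (-1)‖ := by simp
    _ ≤ _ := norm_add_le _ _
    _ ≤ a * (T + 1) + δ := add_le_add (e.trans (by gcongr)) h0
    _ ≤ ((L * C * (2 * (4 + 2 * (2 * T + 1))) + (2 * T + 1)) * δ) * (T + 1) + δ := by gcongr
    _ = _ := by ring

/-! ### Nets -/

theorem tendsto_eps : Tendsto (fun ε : Eps => (ε : ℝ)) toZero (𝓝 0) := tendsto_comap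

theorem eventually_eps_lt {c : ℝ} (hc : 0 < c) : ∀ᶠ ε : Eps in toZero, (ε : ℝ) < c :=
  tendsto_eps.eventually_lt_const hc

theorem exists_Icc_superset {K : Set ℝ} (hK : IsCompact K) :
    ∃ T : ℝ, 1 ≤ T ∧ K ⊆ Set.Icc (-T) T := by
  obtain ⟨T, hT⟩ := hK.isBounded.subset_closedBall 0
  refine ⟨max T 1, le_max_right _ _, fun t ht => ?_⟩
  have := hT ht
  rw [mem_closedBall_zero_iff, Real.norm_eq_abs] at this
  exact abs_le.1 (this.trans (le_max_left _ _))

/-- A moderate net satisfying the negligibility estimates of order zero satisfies those of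
first order. -/
theorem NegligibleOn.deriv_of_moderate {u : Eps → ℝ → ℝ} (hu : IsModerate u)
    (h : ∀ K, IsCompact K → NegligibleOn K u) {K : Set ℝ} (hK : IsCompact K) :
    NegligibleOn K (fun ε => deriv (u ε)) := by
  obtain ⟨T, -, hT⟩ := exists_Icc_superset hK
  intro M
  obtain ⟨N, B, hB⟩ := hu.deriv.deriv.bound (Set.Icc (-T) (T + 1)) isCompact_Icc 0
  -- With step width `ε^(M+N)` in the interpolation, the term `B ε^(-N)` times the step becomes `B
  -- ε^M`, and `2A ε^(M+(M+N))` divided by the step becomes `2A ε^M`. The enlarged interval leaves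
  -- room for one step to the right.
  obtain ⟨A, hA⟩ := h (Set.Icc (-T) (T + 1)) isCompact_Icc (M + (M + N))
  refine ⟨2 * A + B, ?_⟩
  filter_upwards [hB, hA] with ε hB hA t ht
  have hε := ε.2.1
  have hp : (0 : ℝ) < (ε : ℝ) ^ (M + N) := pow_pos hε _
  have hp1 : (ε : ℝ) ^ (M + N) ≤ 1 := pow_le_one₀ hε.le ε.2.2.le
  have sub : Set.Icc t (t + (ε : ℝ) ^ (M + N)) ⊆ Set.Icc (-T) (T + 1) := fun s hs =>
    ⟨(hT ht).1.trans hs.1, by linarith [hs.2, (hT ht).2]⟩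
  refine (abs_deriv_le_of_abs_le (hu.smooth ε) hp (fun s hs => hA s (sub hs))
    (fun s hs => by simpa using hB s (sub hs))).trans (le_of_eq ?_)
  have h1 : (ε : ℝ) ^ (M + N) ≠ 0 := hp.ne'
  have h2 : (ε : ℝ) ^ N ≠ 0 := (pow_pos hε _).ne'
  rw [pow_add (ε : ℝ) M (M + N)]
  field_simp
  rw [pow_add]
  ring

/-- Interpolation passes from one order to the next, and the derivative of a moderate net is again
moderate, so the argument iterates. Equality in `𝓖(ℝ)` thus only requires sup norm estimates. -/
theorem isNegligible_of_order_zero {u : Eps → ℝ → ℝ} (hu : IsModerate u)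
    (h : ∀ K, IsCompact K → NegligibleOn K u) : IsNegligible u := by
  intro K hK k
  induction k generalizing u with
  | zero => simpa using h K hK
  | succ k ih =>
    simp only [iteratedDeriv_succ']
    exact ih hu.deriv fun K hK => NegligibleOn.deriv_of_moderate hu h hK

theorem IsNegligible.order_zero {u : Eps → ℝ → ℝ} (h : IsNegligible u) {K : Set ℝ}
    (hK : IsCompact K) : NegligibleOn K u := by simpa using h K hK 0

/-- The solutions solve the equations only for small `ε`; this is all that matters for the class. -/
theorem mk_eq_mk_of_eventually_eq {U V : moderateNets} (h : ∀ᶠ ε in toZero, U.1 ε = V.1 ε) :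
    mk U = mk V :=
  mk_eq_mk.2 <| isNegligible_of_order_zero (U - V).2 fun _ _ _ => ⟨0, by
    filter_upwards [h] with ε h t _
    have : (U - V).1 ε t = U.1 ε t - V.1 ε t := rfl
    simp [this, h]⟩

/-- A net whose derivative is moderate is moderate if it satisfies the estimates of order zero. -/
theorem IsModerate.of_deriv {u : Eps → ℝ → ℝ} (su : ∀ ε, ContDiff ℝ ∞ (u ε))
    (h0 : ∀ K, IsCompact K → ModerateOn K u) (h : IsModerate fun ε => _root_.deriv (u ε)) :
    IsModerate u where
  smooth := su
  bound K hK k := by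
    cases k with
    | zero => simpa using h0 K hK
    | succ k => simpa only [iteratedDeriv_succ'] using h.bound K hK k

theorem NetLocallyBounded.moderateOn {u : Eps → ℝ → ℝ} (h : NetLocallyBounded u) {K : Set ℝ}
    (hK : IsCompact K) : ModerateOn K u := by
  obtain ⟨C, hC⟩ := h K hK
  exact ⟨0, C, by simpa using hC⟩

/-- The estimates for `f(x_ε)` up to order `k` only use those for `x_ε` up to order `k`. -/
theorem moderateOn_comp_of_le {n : ℕ} {X : Fin n → Eps → ℝ → ℝ}
    (sX : ∀ i ε, ContDiff ℝ ∞ (X i ε)) (bX : ∀ i, NetLocallyBounded (X i))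
    {K : Set ℝ} (hK : IsCompact K) (k : ℕ)
    (hX : ∀ i, ∀ j ≤ k, ModerateOn K (fun ε => iteratedDeriv j (X i ε))) :
    ∀ f : (Fin n → ℝ) → ℝ, ContDiff ℝ ∞ f →
      ModerateOn K (fun ε => iteratedDeriv k (fun t => f fun i => X i ε t)) := by
  have sf : ∀ f : (Fin n → ℝ) → ℝ, ContDiff ℝ ∞ f → ∀ ε,
      ContDiff ℝ ∞ (fun t => f fun i => X i ε t) := fun f hf ε =>
    hf.comp (contDiff_pi.2 fun i => sX i ε)
  induction k using Nat.strong_induction_on with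
  | _ k ih =>
  intro f hf
  cases k with
  | zero =>
    obtain ⟨R, hR⟩ := exists_common_bound bX hK
    obtain ⟨C, hC⟩ := (isCompact_closedBall (0 : Fin n → ℝ) R).exists_bound_of_continuousOn
      hf.continuous.continuousOn
    refine ⟨0, C, ?_⟩
    filter_upwards [hR] with ε h t ht
    simpa using hC _ (h t ht)
  | succ k =>
    have sX' : ∀ i ε, ContDiff ℝ ∞ (deriv (X i ε)) := fun i ε =>
      (contDiff_infty_iff_deriv.1 (sX i ε)).2
    -- `deriv_comp_net` asks for moderate nets, but moderateness of `X` is not yet available. At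
    -- fixed `ε` it is applied to the net that is constant in the index.
    have const : ∀ ε i, IsModerate (fun _ : Eps => X i ε) := fun ε i =>
      ⟨fun _ => sX i ε, fun K hK k => by
        obtain ⟨C, hC⟩ := hK.exists_bound_of_continuousOn
          ((sX i ε).continuous_iteratedDeriv k (by exact_mod_cast le_top)).continuousOn
        exact ⟨0, C, Eventually.of_forall fun _ t ht => by simpa using hC t ht⟩⟩
    have e : (fun ε => iteratedDeriv (k + 1) (fun t => f fun i => X i ε t)) = fun ε t =>
        ∑ i, iteratedDeriv k
          (fun t => partialDeriv i f (fun i => X i ε t) * deriv (X i ε) t) t := by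
      funext ε t
      rw [iteratedDeriv_succ', deriv_comp_net hf (const ε) ε]
      exact iteratedDeriv_fun_sum fun i _ => smooth_at
        ((sf _ (contDiff_partialDeriv hf i) ε).mul (sX' i ε)) k t
    rw [e]
    refine ModerateOn.sum _ fun i _ => ?_
    exact moderateOn_deriv_mul k (sf _ (contDiff_partialDeriv hf i)) (sX' i)
      (fun j hj => ih j (Nat.lt_succ_of_le hj) (fun i l hl => hX i l (by omega)) _
        (contDiff_partialDeriv hf i))
      (fun j hj => by simpa only [iteratedDeriv_succ'] using hX i (j + 1) (by omega))

theorem ModerateOn.congr {K : Set ℝ} {w z : Eps → ℝ → ℝ} (h : ModerateOn K w)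
    (e : ∀ᶠ ε in toZero, z ε = w ε) : ModerateOn K z := by
  obtain ⟨N, C, h⟩ := h
  refine ⟨N, C, ?_⟩
  filter_upwards [h, e] with ε h e
  rwa [e]

/-- Solutions of `ẍ = g(x) ρ` are moderate if they and their first derivatives are bounded. -/
theorem isModerate_of_second_order {n : ℕ} {X : Fin n → Eps → ℝ → ℝ}
    (sX : ∀ i ε, ContDiff ℝ ∞ (X i ε)) (bX : ∀ i, NetLocallyBounded (X i))
    (bX' : ∀ i, NetLocallyBounded fun ε => deriv (X i ε))
    {g : Fin n → (Fin n → ℝ) → ℝ} (hg : ∀ i, ContDiff ℝ ∞ (g i)) {ρ : Eps → ℝ → ℝ}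
    (hρ : IsModerate ρ)
    (hX : ∀ᶠ ε in toZero, ∀ i t, deriv (deriv (X i ε)) t = g i (fun j => X j ε t) * ρ ε t) :
    ∀ i, IsModerate (X i) := by
  refine fun i => ⟨sX i, fun K hK k => ?_⟩
  suffices ∀ k, ∀ j ≤ k, ∀ i, ModerateOn K (fun ε => iteratedDeriv j (X i ε)) from
    this k k le_rfl i
  intro k
  induction k with
  | zero =>
    intro j hj i
    obtain rfl : j = 0 := by omega
    simpa using (bX i).moderateOn hK
  | succ k ih =>
    intro j hj i
    rcases Nat.lt_or_ge j (k + 1) with h | h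
    · exact ih j (by omega) i
    obtain rfl : j = k + 1 := by omega
    -- Order one is the assumed velocity bound. Order `k + 2` is order `k` of `g(x) ρ`, which
    -- involves `x` only up to order `k`.
    cases k with
    | zero => simpa only [iteratedDeriv_succ', iteratedDeriv_zero] using (bX' i).moderateOn hK
    | succ k =>
      have := moderateOn_deriv_mul (K := K) k
        (u := fun ε t => g i (fun j => X j ε t)) (v := ρ)
        (fun ε => (hg i).comp (contDiff_pi.2 fun i => sX i ε)) hρ.smooth
        (fun j hj => moderateOn_comp_of_le sX bX hK j
          (fun i l hl => ih l (by omega) i) _ (hg i)) (fun j _ => hρ.bound K hK j)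
      refine this.congr ?_
      filter_upwards [hX] with ε h
      rw [iteratedDeriv_succ', iteratedDeriv_succ']
      congr 1
      exact funext (h i)

/-! ### Existence of the solution for a fixed regularization parameter -/

/-- Continuity includes the endpoint `-ε`. -/
theorem eq_zero_of_le_neg {r : ℝ → ℝ} (hr : Continuous r) {ε : ℝ}
    (hs : ∀ t, t ∉ Set.Icc (-ε) ε → r t = 0) {t : ℝ} (ht : t ≤ -ε) : r t = 0 :=
  closure_minimal (s := Set.Iio (-ε)) (t := {x | r x = 0})
    (fun y hy => hs y fun hm => absurd hm.1 (not_le.2 hy))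
    (isClosed_eq hr continuous_const) (by rwa [closure_Iio])

theorem integral_smul_eq_zero_of_le_neg {E : Type*} [NormedAddCommGroup E] [NormedSpace ℝ E]
    {r : ℝ → ℝ} (hr : Continuous r) {ε : ℝ} (hs : ∀ t, t ∉ Set.Icc (-ε) ε → r t = 0)
    (g : ℝ → E) {a b : ℝ} (ha : a ≤ -ε) (hb : b ≤ -ε) : ∫ t in a..b, r t • g t = 0 := by
  rw [intervalIntegral.integral_congr (g := fun _ => (0 : E)), intervalIntegral.integral_zero]
  intro t ht
  have : t ≤ -ε := ht.2.trans (max_le ha hb)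
  simp [eq_zero_of_le_neg hr hs this]

/-- Bootstrapping on the pair `(x, y)`: if both are `Cⁿ`, then so are their derivatives `y` and `r
G(x)`. -/
theorem contDiff_of_second_order {E : Type*} [NormedAddCommGroup E] [NormedSpace ℝ E]
    {x y : ℝ → E} {G : E → E} {r : ℝ → ℝ} (hG : ContDiff ℝ ∞ G) (hr : ContDiff ℝ ∞ r)
    (hx : ∀ t, HasDerivAt x (y t) t) (hy : ∀ t, HasDerivAt y (r t • G (x t)) t) :
    ContDiff ℝ ∞ x := by
  have dx : deriv x = y := funext fun t => (hx t).deriv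
  have dy : deriv y = fun t => r t • G (x t) := funext fun t => (hy t).deriv
  suffices ∀ n : ℕ, ContDiff ℝ n x ∧ ContDiff ℝ n y from
    contDiff_infty.2 fun n => (this n).1
  intro n
  induction n with
  | zero =>
    exact ⟨contDiff_zero.2 (continuous_iff_continuousAt.2 fun t => (hx t).continuousAt),
      contDiff_zero.2 (continuous_iff_continuousAt.2 fun t => (hy t).continuousAt)⟩
  | succ n ih =>
    push_cast
    rw [contDiff_succ_iff_deriv, contDiff_succ_iff_deriv, dx, dy]
    exact ⟨⟨fun t => (hx t).differentiableAt, by simp, ih.2⟩,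
      ⟨fun t => (hy t).differentiableAt, by simp,
        (hr.of_le (by exact_mod_cast le_top)).smul
          ((hG.of_le (by exact_mod_cast le_top)).comp ih.1)⟩⟩

/-- The right hand side of the integral equation for `ẍ = r G(x)`. -/
noncomputable def picard {E : Type*} [NormedAddCommGroup E] [NormedSpace ℝ E]
    (x₀ x₁ : E) (ε : ℝ) (h : ℝ → E) (t : ℝ) : E :=
  x₀ + (t + 1) • x₁ + ∫ s in (-ε)..t, ∫ σ in (-ε)..s, h σ

theorem hasDerivAt_integral {E : Type*} [NormedAddCommGroup E] [NormedSpace ℝ E] [CompleteSpace E]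
    {h : ℝ → E} (hc : Continuous h) (a t : ℝ) :
    HasDerivAt (fun s => ∫ σ in a..s, h σ) (h t) t :=
  intervalIntegral.integral_hasDerivAt_right (hc.intervalIntegrable _ _)
    hc.stronglyMeasurable.stronglyMeasurableAtFilter hc.continuousAt

theorem hasDerivAt_picard {E : Type*} [NormedAddCommGroup E] [NormedSpace ℝ E] [CompleteSpace E]
    (x₀ x₁ : E) (ε : ℝ) {h : ℝ → E} (hc : Continuous h) (t : ℝ) :
    HasDerivAt (picard x₀ x₁ ε h) (x₁ + ∫ σ in (-ε)..t, h σ) t := by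
  have c : Continuous fun s => ∫ σ in (-ε)..s, h σ :=
    continuous_iff_continuousAt.2 fun s => (hasDerivAt_integral hc (-ε) s).continuousAt
  have := ((((hasDerivAt_id t).add_const 1).smul_const x₁).const_add x₀).add
    (hasDerivAt_integral c (-ε) t)
  rw [one_smul] at this
  exact this

/-- The fixed point problem is posed on `[-ε, ε]` alone: two solution candidates differ in velocity
by at most `L C` times their distance, hence in position by `2εLC` times it. Starting the integrals
at `-ε` rather than `-1` changes nothing, as `r` vanishes in between. -/
theorem exists_solution {E : Type*} [NormedAddCommGroup E] [NormedSpace ℝ E] [CompleteSpace E]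
    {G : E → E} (hG : ContDiff ℝ ∞ G) {L : NNReal} (hL : LipschitzWith L G)
    {r : ℝ → ℝ} (hr : ContDiff ℝ ∞ r) {ε C : ℝ} (hε : 0 < ε) (hε1 : ε < 1)
    (hs : ∀ t, t ∉ Set.Icc (-ε) ε → r t = 0) (hC : ∫ t, |r t| ≤ C)
    (hsmall : 2 * ε * L * C < 1) (x₀ x₁ : E) :
    ∃ x : ℝ → E, ContDiff ℝ ∞ x ∧ x (-1) = x₀ ∧ deriv x (-1) = x₁ ∧
      ∀ t, deriv (deriv x) t = r t • G (x t) := by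
  have hle : -ε ≤ ε := by linarith
  have hC0 : 0 ≤ C := (integral_nonneg fun t => abs_nonneg (r t)).trans hC
  -- The constant extension outside the interval is arbitrary, since it is multiplied by `r`; it
  -- serves to make `h z` continuous on the whole line.
  let h : C(Set.Icc (-ε) ε, E) → ℝ → E := fun z t => r t • G (Set.IccExtend hle z t)
  have ch : ∀ z, Continuous (h z) := fun z =>
    hr.continuous.smul (hG.continuous.comp z.continuous.Icc_extend')
  have cp : ∀ z, Continuous (picard x₀ x₁ ε (h z)) := fun z =>
    continuous_iff_continuousAt.2 fun t => (hasDerivAt_picard x₀ x₁ ε (ch z) t).continuousAt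
  let Φ : C(Set.Icc (-ε) ε, E) → C(Set.Icc (-ε) ε, E) := fun z =>
    ⟨fun t => picard x₀ x₁ ε (h z) t, (cp z).comp continuous_subtype_val⟩
  have hK0 : 0 ≤ 2 * ε * L * C := by positivity
  have hΦ : ContractingWith ⟨2 * ε * L * C, hK0⟩ Φ := by
    refine ⟨by exact_mod_cast hsmall, LipschitzWith.of_dist_le_mul fun z w => ?_⟩
    rw [ContinuousMap.dist_le (by positivity)]
    intro t
    change dist (picard x₀ x₁ ε (h z) t) (picard x₀ x₁ ε (h w) t) ≤ 2 * ε * L * C * dist z w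
    set d := dist z w
    have hd : 0 ≤ d := dist_nonneg
    have bound : ∀ s, ‖h z s - h w s‖ ≤ (L * d) * |r s| := fun s => by
      rw [← smul_sub, norm_smul, Real.norm_eq_abs, mul_comm]
      gcongr
      rw [← dist_eq_norm]
      exact (hL.dist_le_mul _ _).trans (by gcongr; exact ContinuousMap.dist_apply_le_dist _)
    have e1 : ∀ s ∈ Set.Icc (-ε) ε,
        ‖(x₁ + ∫ σ in (-ε)..s, h z σ) - (x₁ + ∫ σ in (-ε)..s, h w σ)‖ ≤ L * d * C := by
      intro s hs'
      have := norm_sub_le_of_norm_deriv_le (fun s => ((hasDerivAt_integral (ch z) (-ε) s).sub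
        (hasDerivAt_integral (ch w) (-ε) s))) ((ch z).sub (ch w)) hr.continuous hs hC
        (S := L * d) (δ := 0) (by positivity) hs'.1 (fun t _ => by simpa using bound t)
      simpa using this
    have e2 := (convex_Icc (-ε) ε).norm_image_sub_le_of_norm_hasDerivWithin_le
      (fun s _ => ((hasDerivAt_picard x₀ x₁ ε (ch z) s).sub
        (hasDerivAt_picard x₀ x₁ ε (ch w) s)).hasDerivWithinAt) e1
      (⟨le_rfl, hle⟩ : -ε ∈ Set.Icc (-ε) ε) t.2
    have e3 : ‖(t : ℝ) - -ε‖ ≤ 2 * ε := by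
      rw [Real.norm_eq_abs, abs_le]; constructor <;> linarith [t.2.1, t.2.2]
    have e4 : picard x₀ x₁ ε (h z) (-ε) - picard x₀ x₁ ε (h w) (-ε) = 0 := by simp [picard]
    simp only [Pi.sub_apply] at e2
    rw [e4, sub_zero] at e2
    rw [dist_eq_norm]
    calc _ ≤ _ := e2
      _ ≤ L * d * C * (2 * ε) := by gcongr
      _ = _ := by ring
  obtain ⟨z, hz⟩ : ∃ z, Φ z = z := ⟨_, hΦ.fixedPoint_isFixedPt⟩
  -- On the support this is the fixed point equation; elsewhere both sides vanish. Hence the Picard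
  -- formula is a global solution.
  have hx : ∀ t, h z t = r t • G (picard x₀ x₁ ε (h z) t) := fun t => by
    by_cases ht : t ∈ Set.Icc (-ε) ε
    · have : picard x₀ x₁ ε (h z) t = z ⟨t, ht⟩ := congrArg (fun q => q ⟨t, ht⟩) hz
      rw [this]
      simp only [h, Set.IccExtend_of_mem hle _ ht]
    · simp [h, hs t ht]
  have d1 := hasDerivAt_picard x₀ x₁ ε (ch z)
  have d1' : deriv (picard x₀ x₁ ε (h z)) = fun t => x₁ + ∫ σ in (-ε)..t, h z σ :=
    funext fun t => (d1 t).deriv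
  have d2 : ∀ t, HasDerivAt (fun t => x₁ + ∫ σ in (-ε)..t, h z σ)
      (r t • G (picard x₀ x₁ ε (h z) t)) t := fun t => by
    rw [← hx]; exact (hasDerivAt_integral (ch z) (-ε) t).const_add x₁
  have z0 : ∀ s ≤ -ε, ∫ σ in (-ε)..s, h z σ = 0 := fun s h =>
    integral_smul_eq_zero_of_le_neg hr.continuous hs _ le_rfl h
  refine ⟨picard x₀ x₁ ε (h z), contDiff_of_second_order hG hr d1 d2, ?_, ?_, ?_⟩
  · have : ∫ s in (-ε)..(-1), ∫ σ in (-ε)..s, h z σ = 0 := by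
      rw [intervalIntegral.integral_congr (g := fun _ => (0 : E)),
        intervalIntegral.integral_zero]
      exact fun s hs => z0 s (hs.2.trans (max_le le_rfl (by linarith)))
    simp [picard, this]
  · rw [d1']
    simp [z0 (-1) (by linarith)]
  · rw [d1']
    exact fun t => (d2 t).deriv

/-- The velocity is the initial velocity plus the impulse, at most `sup ‖G‖` times the `L¹` norm of
`r`. -/
theorem norm_deriv_le_of_second_order {E : Type*} [NormedAddCommGroup E] [NormedSpace ℝ E] [CompleteSpace E]
    {x : ℝ → E} (sx : ContDiff ℝ ∞ x) {G : E → E} {B : ℝ}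
    (hB : ∀ p, ‖G p‖ ≤ B) {r : ℝ → ℝ} (hr : Continuous r) {ε C : ℝ}
    (hs : ∀ t, t ∉ Set.Icc (-ε) ε → r t = 0) (hC : ∫ t, |r t| ≤ C)
    (hx : ∀ t, deriv (deriv x) t = r t • G (x t)) (t : ℝ) :
    ‖deriv x t‖ ≤ ‖deriv x (-1)‖ + B * C := by
  have sx' := (contDiff_infty_iff_deriv.1 sx).2
  have d : ∀ t, HasDerivAt (deriv x) (deriv (deriv x) t) t := fun t =>
    (sx'.differentiable (by simp) t).hasDerivAt
  have c : Continuous (deriv (deriv x)) := ((contDiff_infty_iff_deriv.1 sx').2).continuous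
  have hB0 : 0 ≤ B := (norm_nonneg _).trans (hB 0)
  have b : ∀ t, ‖deriv (deriv x) t‖ ≤ B * |r t| + 0 := fun t => by
    rw [hx, norm_smul, Real.norm_eq_abs, mul_comm, add_zero]
    gcongr; exact hB _
  have key : ‖deriv x t - deriv x (-1)‖ ≤ B * C := by
    rcases le_total (-1) t with h | h
    · simpa using norm_sub_le_of_norm_deriv_le d c hr hs hC hB0 h fun t _ => b t
    · rw [norm_sub_rev]
      simpa using norm_sub_le_of_norm_deriv_le d c hr hs hC hB0 h fun t _ => b t
  calc ‖deriv x t‖ = ‖deriv x (-1) + (deriv x t - deriv x (-1))‖ := by simp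
    _ ≤ _ := norm_add_le _ _
    _ ≤ _ := by gcongr

/-- On the support of the strict delta net the solution is close to the point at which the
unperturbed straight line meets the shock. -/
theorem norm_sub_le_of_second_order {E : Type*} [NormedAddCommGroup E] [NormedSpace ℝ E]
    {x : ℝ → E} (sx : ContDiff ℝ ∞ x) {g : ℝ → E}
    {r : ℝ → ℝ} (hr : Continuous r) {ε Y : ℝ} (hε : 0 < ε) (hε1 : ε < 1)
    (hs : ∀ t, t ∉ Set.Icc (-ε) ε → r t = 0)
    (hx : ∀ t, deriv (deriv x) t = r t • g t) (hY : ∀ t, ‖deriv x t‖ ≤ Y)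
    {t : ℝ} (ht : t ∈ Set.Icc (-ε) ε) :
    ‖x t - (x (-1) + deriv x (-1))‖ ≤ 3 * Y * ε := by
  have sx' := (contDiff_infty_iff_deriv.1 sx).2
  have dx : ∀ t, HasDerivAt x (deriv x t) t := fun t =>
    (sx.differentiable (by simp) t).hasDerivAt
  have dx' : ∀ t, HasDerivAt (deriv x) (deriv (deriv x) t) t := fun t =>
    (sx'.differentiable (by simp) t).hasDerivAt
  have hY0 : 0 ≤ Y := (norm_nonneg _).trans (hY 0)
  have m1 : (-1 : ℝ) ∈ Set.Icc (-1) (-ε) := ⟨le_rfl, by linarith⟩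
  have m2 : -ε ∈ Set.Icc (-1) (-ε) := ⟨by linarith, le_rfl⟩
  have e1 : ∀ s ∈ Set.Icc (-1) (-ε), ‖deriv x s - deriv x (-1)‖ ≤ 0 := fun s hs' => by
    simpa using (convex_Icc (-1) (-ε)).norm_image_sub_le_of_norm_hasDerivWithin_le (C := 0)
      (fun s _ => (dx' s).hasDerivWithinAt)
      (fun s hs' => by simp [hx, eq_zero_of_le_neg hr hs hs'.2]) m1 hs'
  -- Free motion before the shock: `x s - s x'(-1)` has zero derivative on `[-1, -ε]`.
  have e2 : x (-ε) = x (-1) + (1 - ε) • deriv x (-1) := by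
    have := (convex_Icc (-1) (-ε)).norm_image_sub_le_of_norm_hasDerivWithin_le (C := 0)
      (f := fun s => x s - s • deriv x (-1)) (f' := fun s => deriv x s - (1 : ℝ) • deriv x (-1))
      (fun s _ => ((dx s).sub ((hasDerivAt_id s).smul_const _)).hasDerivWithinAt)
      (fun s hs' => by simpa using e1 s hs') m1 m2
    simp only [zero_mul, norm_le_zero_iff, sub_eq_zero] at this
    rw [sub_eq_iff_eq_add.1 this]
    module
  have e3 : ‖x t - x (-ε)‖ ≤ Y * (2 * ε) := by
    refine (convex_univ.norm_image_sub_le_of_norm_hasDerivWithin_le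
      (fun s _ => (dx s).hasDerivWithinAt) (fun s _ => hY s) (Set.mem_univ (-ε))
      (Set.mem_univ t)).trans ?_
    gcongr
    rw [Real.norm_eq_abs, abs_le]; constructor <;> linarith [ht.1, ht.2]
  -- The constant 3 is 2 for crossing the support at speed `Y`, plus 1 for the missing piece `ε
  -- x'(-1)` of the straight line between `-ε` and `0`.
  calc ‖x t - (x (-1) + deriv x (-1))‖ = ‖(x t - x (-ε)) - ε • deriv x (-1)‖ := by
        rw [e2]; congr 1; module
    _ ≤ ‖x t - x (-ε)‖ + ‖ε • deriv x (-1)‖ := norm_sub_le _ _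
    _ ≤ Y * (2 * ε) + ε * Y := by
        rw [norm_smul, Real.norm_eq_abs, abs_of_pos hε]
        gcongr
        exact hY _
    _ = 3 * Y * ε := by ring

/-- Multiplication by a bump function equal to 1 on the unit ball; compact support gives the global
bounds. -/
theorem exists_cutoff {E : Type*} [NormedAddCommGroup E] [NormedSpace ℝ E]
    [FiniteDimensional ℝ E] {g : E → E} (hg : ContDiff ℝ ∞ g) (p : E) :
    ∃ G : E → E, ContDiff ℝ ∞ G ∧ (∃ L, LipschitzWith L G) ∧ (∃ B, ∀ q, ‖G q‖ ≤ B) ∧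
      ∀ q ∈ Metric.closedBall p 1, G q = g q := by
  let χ : ContDiffBump p := ⟨1, 2, one_pos, one_lt_two⟩
  have hs : ContDiff ℝ ∞ (fun q => χ q • g q) := χ.contDiff.smul hg
  have hc : HasCompactSupport (fun q => χ q • g q) := χ.hasCompactSupport.smul_right
  exact ⟨_, hs, hs.lipschitzWith_of_hasCompactSupport hc (by simp),
    hc.exists_bound_of_continuous hs.continuous, fun q hq => by
      simp [χ.one_of_mem_closedBall hq]⟩

/-- Solutions of `ẍ = ρ g(x)` for small `ε`, where `ρ` is a strict delta net. -/
theorem exists_solution_net {E : Type*} [NormedAddCommGroup E] [NormedSpace ℝ E]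
    [FiniteDimensional ℝ E] {g : E → E} (hg : ContDiff ℝ ∞ g)
    {ρ : Eps → ℝ → ℝ} (sρ : ∀ ε, ContDiff ℝ ∞ (ρ ε))
    (hs : ∀ ε : Eps, ∀ t, t ∉ Set.Icc (-(ε : ℝ)) ε → ρ ε t = 0) {C : ℝ}
    (hC : ∀ᶠ ε in toZero, ∫ t, |ρ ε t| ≤ C) (x₀ x₁ : E) :
    ∃ X : Eps → ℝ → E, (∀ ε, ContDiff ℝ ∞ (X ε)) ∧ ∃ Y, ∀ᶠ ε in toZero,
      X ε (-1) = x₀ ∧ deriv (X ε) (-1) = x₁ ∧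
      (∀ t, deriv (deriv (X ε)) t = ρ ε t • g (X ε t)) ∧ (∀ t, ‖deriv (X ε) t‖ ≤ Y) ∧
      ∀ t ∈ Set.Icc (-(ε : ℝ)) ε, ‖X ε t - (x₀ + x₁)‖ ≤ Y * ε := by
  obtain ⟨G, sG, ⟨L, hL⟩, ⟨B, hB⟩, hGg⟩ := exists_cutoff hg (x₀ + x₁)
  have hB0 : 0 ≤ B := (norm_nonneg _).trans (hB 0)
  -- A net must be smooth for every `ε`; where the smallness conditions fail, the zero function is
  -- used.
  have ex : ∀ ε : Eps, ∃ x : ℝ → E, ContDiff ℝ ∞ x ∧ (∫ t, |ρ ε t| ≤ C → 2 * (ε : ℝ) * L * C < 1 →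
      x (-1) = x₀ ∧ deriv x (-1) = x₁ ∧ ∀ t, deriv (deriv x) t = ρ ε t • G (x t)) := by
    intro ε
    by_cases h : ∫ t, |ρ ε t| ≤ C ∧ 2 * (ε : ℝ) * L * C < 1
    · obtain ⟨x, h1, h2⟩ := exists_solution sG hL (sρ ε) ε.2.1 ε.2.2 (hs ε) h.1 h.2 x₀ x₁
      exact ⟨x, h1, fun _ _ => h2⟩
    · exact ⟨0, contDiff_const, fun h1 h2 => absurd ⟨h1, h2⟩ h⟩
  choose X sX hX using ex
  set Y := ‖x₁‖ + B * C
  refine ⟨X, sX, max Y (3 * Y), ?_⟩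
  have t1 : Tendsto (fun ε : Eps => 2 * (ε : ℝ) * L * C) toZero (𝓝 0) := by
    simpa using ((tendsto_eps.const_mul 2).mul_const (L : ℝ)).mul_const C
  have t2 : Tendsto (fun ε : Eps => 3 * Y * (ε : ℝ)) toZero (𝓝 0) := by
    simpa using tendsto_eps.const_mul (3 * Y)
  filter_upwards [hC, t1.eventually_lt_const one_pos, t2.eventually_lt_const one_pos]
    with ε h1 h2 h3
  obtain ⟨i0, i1, eq⟩ := hX ε h1 h2
  have hY : ∀ t, ‖deriv (X ε) t‖ ≤ Y := fun t => by
    simpa [i1] using norm_deriv_le_of_second_order (sX ε) hB (sρ ε).continuous (hs ε) h1 eq t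
  have near : ∀ t ∈ Set.Icc (-(ε : ℝ)) ε, ‖X ε t - (x₀ + x₁)‖ ≤ 3 * Y * ε := fun t ht => by
    simpa [i0, i1] using norm_sub_le_of_second_order (sX ε) (g := fun t => G (X ε t))
      (sρ ε).continuous ε.2.1 ε.2.2 (hs ε) eq hY ht
  refine ⟨i0, i1, fun t => ?_, fun t => (hY t).trans (le_max_left _ _), fun t ht =>
    (near t ht).trans ?_⟩
  -- `G` may be replaced by `g`: on the support the solution is within distance 1 of `x₀ + x₁`, and
  -- off the support `ρ` kills both.
  · rw [eq]
    by_cases ht : t ∈ Set.Icc (-(ε : ℝ)) ε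
    · rw [hGg]
      rw [Metric.mem_closedBall, dist_eq_norm]
      exact (near t ht).trans h3.le
    · simp [hs ε t ht]
  · have := ε.2.1.le
    gcongr
    exact le_max_right _ _

/-! ### Strict delta nets -/

/-- The defining properties of the representatives of generalized delta functions. -/
structure IsDeltaNet (ρ : Eps → ℝ → ℝ) (C : ℝ) : Prop where
  moderate : IsModerate ρ
  eq_zero : ∀ ε : Eps, ∀ t, t ∉ Set.Icc (-(ε : ℝ)) ε → ρ ε t = 0
  tendsto : Tendsto (fun ε : Eps => ∫ t, ρ ε t) toZero (𝓝 1)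
  bound : ∀ᶠ ε in toZero, ∫ t, |ρ ε t| ≤ C

theorem IsGeneralizedDelta.exists_isDeltaNet {ρ : ColombeauAlgebra} (h : IsGeneralizedDelta ρ) :
    ∃ (R : moderateNets) (C : ℝ), mk R = ρ ∧ IsDeltaNet R.1 C := by
  obtain ⟨R, hR, hs, ht, C, hC⟩ := h
  exact ⟨R, C, hR, R.2, fun ε t ht => image_eq_zero_of_notMem_tsupport fun h => ht (hs ε h),
    ht, hC⟩

/-! ### Uniqueness -/

theorem HasValueAt.abs_sub_le {u v : ColombeauAlgebra} {t c : ℝ} (hu : HasValueAt u t c)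
    (hv : HasValueAt v t c) {U V : moderateNets} (hU : mk U = u) (hV : mk V = v) (M : ℕ) :
    ∃ C : ℝ, ∀ᶠ ε in toZero, |U.1 ε t - V.1 ε t| ≤ C * (ε : ℝ) ^ M := by
  obtain ⟨C, hC⟩ := hu U hU M
  obtain ⟨C', hC'⟩ := hv V hV M
  refine ⟨C + C', ?_⟩
  filter_upwards [hC, hC'] with ε h h'
  calc |U.1 ε t - V.1 ε t| ≤ |U.1 ε t - c| + |c - V.1 ε t| := _root_.abs_sub_le _ _ _
    _ ≤ C * (ε : ℝ) ^ M + C' * (ε : ℝ) ^ M := by rw [abs_sub_comm c]; exact add_le_add h h'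
    _ = _ := by ring

theorem hasValueAt_mk_of_eventually_eq {U : moderateNets} {t c : ℝ}
    (h : ∀ᶠ ε in toZero, U.1 ε t = c) : HasValueAt (mk U) t c := by
  intro V hV M
  obtain ⟨C, hC⟩ := (mk_eq_mk.1 hV).order_zero (isCompact_singleton (x := t)) M
  refine ⟨C, ?_⟩
  filter_upwards [h, hC] with ε h hC
  have := hC t rfl
  rwa [← h]

/-- Uniqueness for `ẍ = g(x) ρ` in the Colombeau algebra, on the level of representatives. -/
theorem mk_eq_mk_of_second_order {n : ℕ} {X Y : Fin n → moderateNets}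
    (bX : ∀ i, NetLocallyBounded (X i).1) (bY : ∀ i, NetLocallyBounded (Y i).1)
    {g : Fin n → (Fin n → ℝ) → ℝ} (hg : ∀ i, ContDiff ℝ ∞ (g i)) {ρ : Eps → ℝ → ℝ} {C : ℝ}
    (hρ : IsDeltaNet ρ C)
    (hXY : ∀ i K, IsCompact K → NegligibleOn K fun ε t =>
      deriv (deriv ((X i).1 ε)) t - deriv (deriv ((Y i).1 ε)) t -
        (g i (fun j => (X j).1 ε t) - g i (fun j => (Y j).1 ε t)) * ρ ε t)
    (h0 : ∀ i (M : ℕ), ∃ C : ℝ, ∀ᶠ ε in toZero,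
      |(X i).1 ε (-1) - (Y i).1 ε (-1)| ≤ C * (ε : ℝ) ^ M)
    (h1 : ∀ i (M : ℕ), ∃ C : ℝ, ∀ᶠ ε in toZero,
      |deriv ((X i).1 ε) (-1) - deriv ((Y i).1 ε) (-1)| ≤ C * (ε : ℝ) ^ M) (i : Fin n) :
    mk (X i) = mk (Y i) := by
  refine mk_eq_mk.2 (isNegligible_of_order_zero (X i - Y i).2 fun K hK M => ?_)
  obtain ⟨T, hT1, hKT⟩ := exists_Icc_superset hK
  obtain ⟨r, hr⟩ := exists_common_bound bX (isCompact_Icc (a := -T) (b := T))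
  obtain ⟨r', hr'⟩ := exists_common_bound bY (isCompact_Icc (a := -T) (b := T))
  -- Collecting the `g i` in one map gives a single Lipschitz constant on a ball containing both
  -- nets over `[-T, T]`; local boundedness of the solutions is used here.
  have sg : ContDiff ℝ 1 (fun p => fun i => g i p) :=
    contDiff_pi.2 fun i => (hg i).of_le (by simp)
  obtain ⟨L, hL⟩ := (sg.locallyLipschitz.locallyLipschitzOn
    (s := Metric.closedBall 0 (max r r'))).exists_lipschitzOnWith_of_compact
      (isCompact_closedBall _ _)
  choose A hA using fun i => hXY i _ (isCompact_Icc (a := -T) (b := T)) M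
  choose A0 hA0 using fun i => h0 i M
  choose A1 hA1 using fun i => h1 i M
  set D := ∑ i, (|A i| + |A0 i| + |A1 i|) with hD
  have D0 : 0 ≤ D := Finset.sum_nonneg fun i _ => by positivity
  have hDi : ∀ i, |A i| + |A0 i| + |A1 i| ≤ D := fun i =>
    Finset.single_le_sum (f := fun i => |A i| + |A0 i| + |A1 i|)
      (fun i _ => by positivity) (Finset.mem_univ i)
  have t1 : Tendsto (fun ε : Eps => 4 * (ε : ℝ) * L * C) toZero (𝓝 0) := by
    simpa using ((tendsto_eps.const_mul 4).mul_const (L : ℝ)).mul_const C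
  refine ⟨(1 + (T + 1) * (L * C * (2 * (4 + 2 * (2 * T + 1))) + (2 * T + 1))) * D, ?_⟩
  filter_upwards [hr, hr', eventually_all.2 hA, eventually_all.2 hA0, eventually_all.2 hA1,
    hρ.bound, t1.eventually_lt_const one_pos] with ε hr hr' hA hA0 hA1 hC hsmall t ht
  have hε : 0 ≤ (ε : ℝ) ^ M := pow_nonneg ε.2.1.le _
  have dX : ∀ (U : moderateNets) t, HasDerivAt (U.1 ε) (deriv (U.1 ε) t) t := fun U t =>
    ((U.2.smooth ε).differentiable (by simp) t).hasDerivAt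
  set w : ℝ → Fin n → ℝ := fun t i => (X i).1 ε t - (Y i).1 ε t
  set w' : ℝ → Fin n → ℝ := fun t i => deriv ((X i).1 ε) t - deriv ((Y i).1 ε) t
  set w'' : ℝ → Fin n → ℝ :=
    fun t i => deriv (deriv ((X i).1 ε)) t - deriv (deriv ((Y i).1 ε)) t
  have dw : ∀ t, HasDerivAt w (w' t) t := fun t =>
    hasDerivAt_pi.2 fun i => (dX (X i) t).sub (dX (Y i) t)
  have dw' : ∀ t, HasDerivAt w' (w'' t) t := fun t =>
    hasDerivAt_pi.2 fun i => (dX (derivNet (X i)) t).sub (dX (derivNet (Y i)) t)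
  have cw : Continuous w'' := continuous_pi fun i =>
    ((derivNet (derivNet (X i))).2.smooth ε).continuous.sub
      ((derivNet (derivNet (Y i))).2.smooth ε).continuous
  have key := norm_le_of_delta_driven dw dw' cw (hρ.moderate.smooth ε).continuous
    (L := L) (δ := D * (ε : ℝ) ^ M) ε.2.1 ε.2.2 (hρ.eq_zero ε) hC L.2 hT1 hsmall.le ?_ ?_ ?_ t
    (hKT ht)
  · have hi : |(X i).1 ε t - (Y i).1 ε t| ≤ ‖w t‖ := norm_le_pi_norm (w t) i
    have : (X i - Y i).1 ε t = (X i).1 ε t - (Y i).1 ε t := rfl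
    rw [this, mul_assoc]
    exact hi.trans key
  · refine (pi_norm_le_iff_of_nonneg (by positivity)).2 fun i => (hA0 i).trans ?_
    gcongr
    linarith [hDi i, abs_nonneg (A i), abs_nonneg (A1 i), le_abs_self (A0 i)]
  · refine (pi_norm_le_iff_of_nonneg (by positivity)).2 fun i => (hA1 i).trans ?_
    gcongr
    linarith [hDi i, abs_nonneg (A i), abs_nonneg (A0 i), le_abs_self (A1 i)]
  · intro t ht
    have hp := hL.norm_sub_le (Metric.closedBall_subset_closedBall (le_max_left r r') (hr t ht))
      (Metric.closedBall_subset_closedBall (le_max_right r r') (hr' t ht))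
    have e : ((fun j => (X j).1 ε t) - fun j => (Y j).1 ε t) = w t := rfl
    rw [e] at hp
    refine (pi_norm_le_iff_of_nonneg (by positivity)).2 fun i => ?_
    have n1 := hA i t ht
    have n2 := (norm_le_pi_norm _ i).trans hp
    simp only [Pi.sub_apply, Real.norm_eq_abs] at n2
    have n3 : A i * (ε : ℝ) ^ M ≤ D * (ε : ℝ) ^ M := by
      gcongr
      linarith [hDi i, abs_nonneg (A1 i), abs_nonneg (A0 i), le_abs_self (A i)]
    have n4 : |(g i (fun j => (X j).1 ε t) - g i (fun j => (Y j).1 ε t)) * ρ ε t| ≤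
        L * |ρ ε t| * ‖w t‖ := by
      rw [abs_mul]
      calc _ ≤ (L * ‖w t‖) * |ρ ε t| := by gcongr
        _ = _ := by ring
    have n5 := abs_add_le
      (deriv (deriv ((X i).1 ε)) t - deriv (deriv ((Y i).1 ε)) t -
        (g i (fun j => (X j).1 ε t) - g i (fun j => (Y j).1 ε t)) * ρ ε t)
      ((g i (fun j => (X j).1 ε t) - g i (fun j => (Y j).1 ε t)) * ρ ε t)
    rw [sub_add_cancel] at n5
    change |deriv (deriv ((X i).1 ε)) t - deriv (deriv ((Y i).1 ε)) t| ≤ _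
    linarith

/-- The equations for `x` are decoupled from `v` and are treated first. Once `x = y`, the right hand
sides for `v` and `w` coincide in `𝓖(ℝ)`. -/
theorem locallyBoundedGeodesic_unique {f : (Fin 2 → ℝ) → ℝ} {hf : ContDiff ℝ ∞ f}
    {ρ : ColombeauAlgebra} (hρ : IsGeneralizedDelta ρ) {v₀ v₁ : ℝ} {x₀ x₁ : Fin 2 → ℝ}
    {v w : ColombeauAlgebra} {x y : Fin 2 → ColombeauAlgebra}
    (hx : IsLocallyBoundedGeodesic f hf ρ v₀ v₁ x₀ x₁ v x)
    (hy : IsLocallyBoundedGeodesic f hf ρ v₀ v₁ x₀ x₁ w y) : v = w ∧ x = y := by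
  obtain ⟨R, C, rfl, hR⟩ := hρ.exists_isDeltaNet
  have hxy : x = y := by
    choose X hX bX using hx.x_bdd
    choose Y hY bY using hy.x_bdd
    have eqn : ∀ {v x} (h : IsLocallyBoundedGeodesic f hf (mk R) v₀ v₁ x₀ x₁ v x)
        (X : Fin 2 → moderateNets) (hX : ∀ i, mk (X i) = x i)
        (bX : ∀ i, NetLocallyBounded (X i).1) (i : Fin 2),
        IsNegligible (derivNet (derivNet (X i)) - (1 / 2 : ℝ) •
          (compNet (partialDeriv i f) (contDiff_partialDeriv hf i) X bX * R)).1 := by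
      intro v x h X hX bX i
      have := h.x_eq i
      rw [comp_eq_mk _ h.x_bdd X bX hX, ← hX i, D_mk, D_mk] at this
      exact mk_eq_mk.1 this
    funext i
    rw [← hX i, ← hY i]
    refine mk_eq_mk_of_second_order bX bY (g := fun i p => 1 / 2 * partialDeriv i f p)
      (fun i => contDiff_const.mul (contDiff_partialDeriv hf i)) hR (fun i K hK => ?_)
      (fun i M => (hx.x_init i).abs_sub_le (hy.x_init i) (hX i) (hY i) M)
      (fun i M => (hx.x_init' i).abs_sub_le (hy.x_init' i) (U := derivNet (X i))
        (V := derivNet (Y i)) (by rw [← hX i, D_mk]) (by rw [← hY i, D_mk]) M) i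
    have := (negligibleNets.sub_mem (eqn hx X hX bX i) (eqn hy Y hY bY i) :
      IsNegligible _).order_zero hK
    convert this using 3 with ε t
    change _ = (deriv (deriv ((X i).1 ε)) t -
      1 / 2 * (partialDeriv i f (fun j => (X j).1 ε t) * R.1 ε t)) -
      (deriv (deriv ((Y i).1 ε)) t -
      1 / 2 * (partialDeriv i f (fun j => (Y j).1 ε t) * R.1 ε t))
    ring
  subst hxy
  refine ⟨?_, rfl⟩
  obtain ⟨V, hV, bV⟩ := hx.v_bdd
  obtain ⟨W, hW, bW⟩ := hy.v_bdd
  have e : mk (derivNet (derivNet V)) = mk (derivNet (derivNet W)) := by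
    rw [← D_mk, ← D_mk, ← D_mk, ← D_mk, hV, hW, hx.v_eq, hy.v_eq]
  rw [← hV, ← hW]
  -- With `g = 0` the stability lemma reduces to integrating a negligible second derivative twice.
  refine mk_eq_mk_of_second_order (n := 1) (X := fun _ => V) (Y := fun _ => W)
    (fun _ => bV) (fun _ => bW) (g := fun _ _ => 0) (fun _ => contDiff_const) hR
    (fun i K hK => ?_) (fun i M => hx.v_init.abs_sub_le hy.v_init hV hW M)
    (fun i M => hx.v_init'.abs_sub_le hy.v_init' (U := derivNet V)
      (V := derivNet W) (by rw [← hV, D_mk]) (by rw [← hW, D_mk]) M) 0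
  simp only [sub_self, zero_mul, sub_zero]
  exact (mk_eq_mk.1 e).order_zero hK

/-! ### Limits of integrals -/

theorem heaviside_of_pos {t : ℝ} (h : 0 < t) : heaviside t = 1 := if_pos h

theorem heaviside_of_nonpos {t : ℝ} (h : t ≤ 0) : heaviside t = 0 := if_neg (not_lt.2 h)

theorem heaviside_mul_self (t : ℝ) : heaviside t * heaviside t = heaviside t := by
  rcases lt_or_ge 0 t with h | h
  · simp [heaviside_of_pos h]
  · simp [heaviside_of_nonpos h]

theorem heaviside_eq_indicator : heaviside = (Set.Ioi 0).indicator fun _ => 1 := by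
  funext t
  simp [heaviside, Set.indicator_apply]

theorem locallyIntegrable_heaviside : LocallyIntegrable heaviside := by
  rw [heaviside_eq_indicator]
  exact (locallyIntegrable_const 1).indicator measurableSet_Ioi

theorem continuous_kink : Continuous kink := by
  have : kink = fun t => max t 0 := by
    funext t
    rcases lt_or_ge 0 t with h | h
    · simp [kink, heaviside_of_pos h, h.le]
    · simp [kink, heaviside_of_nonpos h, h]
  rw [this]
  exact continuous_id.max continuous_const

theorem integral_heaviside (t : ℝ) : ∫ s in (-1)..t, heaviside s = kink t := by
  have neg : ∀ a ≤ 0, ∫ s in (-1)..a, heaviside s = 0 := fun a ha => by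
    rw [intervalIntegral.integral_congr (g := fun _ => (0 : ℝ)), intervalIntegral.integral_zero]
    exact fun s hs => heaviside_of_nonpos (hs.2.trans (max_le (by norm_num) ha))
  rcases lt_or_ge 0 t with h | h
  · have hi : ∀ a b, IntervalIntegrable heaviside volume a b := fun a b =>
      (locallyIntegrable_heaviside.integrableOn_isCompact isCompact_uIcc).intervalIntegrable
    rw [← intervalIntegral.integral_add_adjacent_intervals (hi (-1) 0) (hi 0 t), neg 0 le_rfl,
      intervalIntegral.integral_of_le h.le,
      setIntegral_congr_fun (g := fun _ => (1 : ℝ)) measurableSet_Ioc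
        fun s hs => heaviside_of_pos hs.1]
    simp [kink, heaviside_of_pos h, h.le]
  · rw [neg t h]
    simp [kink, heaviside_of_nonpos h]

/-- Dominated convergence on `[-1, t]`; the origin is a null set. A jump in the integrand becomes a
kink in the integral. -/
theorem tendsto_integral_of_tendsto_heaviside {q : Eps → ℝ → ℝ}
    (hq : ∀ ε, Continuous (q ε)) {B : ℝ} (hB : ∀ᶠ ε in toZero, ∀ t, |q ε t| ≤ B) {a b : ℝ}
    (h : ∀ t ≠ 0, Tendsto (fun ε => q ε t) toZero (𝓝 (a + b * heaviside t))) (t : ℝ) :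
    Tendsto (fun ε => ∫ s in (-1)..t, q ε s) toZero (𝓝 (a * (1 + t) + b * kink t)) := by
  have hi : IntervalIntegrable heaviside volume (-1) t :=
    (locallyIntegrable_heaviside.integrableOn_isCompact isCompact_uIcc).intervalIntegrable
  have e : ∫ s in (-1)..t, (a + b * heaviside s) = a * (1 + t) + b * kink t := by
    rw [intervalIntegral.integral_add intervalIntegrable_const (hi.const_mul b),
      intervalIntegral.integral_const_mul, integral_heaviside, intervalIntegral.integral_const,
      smul_eq_mul]
    ring
  rw [← e]
  -- Dominated convergence along a filter requires a countable base.
  have : toZero.IsCountablyGenerated := by unfold toZero; infer_instance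
  refine intervalIntegral.tendsto_integral_filter_of_dominated_convergence (fun _ => B)
    (Eventually.of_forall fun ε => (hq ε).aestronglyMeasurable) ?_ intervalIntegrable_const ?_
  · filter_upwards [hB] with ε hB
    exact Eventually.of_forall fun t _ => hB t
  · have : ∀ᵐ s : ℝ ∂volume, s ≠ 0 := by simp [ae_iff]
    filter_upwards [this] with s hs _ using h s hs

/-- `g_ε` is uniformly close to `c` on the shrinking support, so the uniform `L¹` bound lets it be
replaced by `c`; the mass of `ρ_ε` then passes `t` entirely or not at all. The bound is essential
because `ρ_ε` may change sign. -/
theorem IsDeltaNet.tendsto_integral_mul {ρ : Eps → ℝ → ℝ} {C : ℝ} (hρ : IsDeltaNet ρ C)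
    {g : Eps → ℝ → ℝ} (hg : ∀ ε, Continuous (g ε)) {c : ℝ}
    (hgc : ∀ η > 0, ∀ᶠ ε : Eps in toZero, ∀ t ∈ Set.Icc (-(ε : ℝ)) ε, |g ε t - c| ≤ η)
    {t : ℝ} (ht : t ≠ 0) :
    Tendsto (fun ε => ∫ s in (-1)..t, ρ ε s * g ε s) toZero (𝓝 (c * heaviside t)) := by
  have cρ : ∀ ε, Continuous (ρ ε) := fun ε => (hρ.moderate.smooth ε).continuous
  rcases lt_or_gt_of_ne ht with h | h
  · rw [heaviside_of_nonpos h.le, mul_zero]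
    refine tendsto_const_nhds.congr' ?_
    filter_upwards [eventually_eps_lt (neg_pos.2 h)] with ε hε
    exact (integral_smul_eq_zero_of_le_neg (cρ ε) (hρ.eq_zero ε) (g ε)
      (by linarith [ε.2.2]) (by linarith)).symm
  · rw [heaviside_of_pos h, mul_one]
    have h1 : Tendsto (fun ε => ∫ s in (-1)..t, ρ ε s) toZero (𝓝 1) := by
      refine hρ.tendsto.congr' ?_
      filter_upwards [eventually_eps_lt h] with ε hε
      rw [intervalIntegral.integral_of_le (by linarith)]
      refine (setIntegral_eq_integral_of_forall_compl_eq_zero fun s hs => ?_).symm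
      refine hρ.eq_zero ε s fun hm => hs ⟨?_, ?_⟩ <;> linarith [hm.1, hm.2, ε.2.2]
    have h2 : Tendsto (fun ε => ∫ s in (-1)..t, ρ ε s * (g ε s - c)) toZero (𝓝 0) := by
      rw [Metric.tendsto_nhds]
      intro η hη
      -- `|C| + 1` avoids division by zero, and the factor 2 leaves `η / 2 < η`.
      filter_upwards [hgc (η / (2 * (|C| + 1))) (by positivity), hρ.bound] with ε hε hC
      have hle : (-1 : ℝ) ≤ t := by linarith
      rw [dist_zero_right]
      calc ‖∫ s in (-1)..t, ρ ε s * (g ε s - c)‖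
          ≤ ∫ s in (-1)..t, η / (2 * (|C| + 1)) * |ρ ε s| := by
            refine intervalIntegral.norm_integral_le_of_norm_le hle
              (Eventually.of_forall fun s _ => ?_)
              ((continuous_const.mul (cρ ε).abs).intervalIntegrable _ _)
            rw [Real.norm_eq_abs, abs_mul, mul_comm]
            by_cases hs : s ∈ Set.Icc (-(ε : ℝ)) ε
            · gcongr; exact hε s hs
            · simp [hρ.eq_zero ε s hs]
        _ ≤ η / (2 * (|C| + 1)) * C := by
            rw [intervalIntegral.integral_const_mul]
            gcongr
            exact integral_abs_interval_le (cρ ε) (hρ.eq_zero ε) hC hle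
        _ ≤ η / (2 * (|C| + 1)) * (|C| + 1) := by gcongr; linarith [le_abs_self C]
        _ = η / 2 := by field_simp
        _ < η := by linarith
    have h3 := h2.add (h1.mul_const c)
    rw [zero_add, one_mul] at h3
    refine h3.congr fun ε => ?_
    rw [← intervalIntegral.integral_mul_const, ← intervalIntegral.integral_add]
    · congr 1; funext s; ring
    · exact ((cρ ε).mul ((hg ε).sub continuous_const)).intervalIntegrable _ _
    · exact ((cρ ε).mul continuous_const).intervalIntegrable _ _

/-- A locally bounded net which converges pointwise off the origin converges in `𝓓'(ℝ)`. -/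
theorem associated_of_tendsto {U : moderateNets} (bU : NetLocallyBounded U.1) {w : ℝ → ℝ}
    (hw : LocallyIntegrable w)
    (h : ∀ t ≠ 0, Tendsto (fun ε => U.1 ε t) toZero (𝓝 (w t))) : Associated (mk U) w := by
  refine ⟨hw, fun V hV φ => ?_⟩
  have hVU : IsNegligible (V - U).1 := mk_eq_mk.1 hV
  have sub : ∀ ε t, V.1 ε t = (V - U).1 ε t + U.1 ε t := fun ε t =>
    (sub_add_cancel (V.1 ε t) (U.1 ε t)).symm
  have cφ : Continuous φ := φ.continuous
  have sφ : HasCompactSupport φ := φ.hasCompactSupport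
  obtain ⟨C, hC⟩ := bU _ sφ
  -- Exponent 0 suffices: an arbitrary representative differs from `U` by a net bounded on the
  -- support of `φ`.
  obtain ⟨C', hC'⟩ := hVU.order_zero sφ 0
  have : toZero.IsCountablyGenerated := by unfold toZero; infer_instance
  have i1 : Integrable (fun t => (C' + C) * |φ t| + |w t * φ t|) := by
    refine Integrable.add ?_
      (hw.integrable_smul_right_of_hasCompactSupport cφ sφ).norm
    exact (cφ.norm.integrable_of_hasCompactSupport sφ.norm).const_mul _
  have := tendsto_integral_filter_of_dominated_convergence
    (F := fun (ε : Eps) t => (V.1 ε t - w t) * φ t) (f := fun _ => (0 : ℝ)) (μ := volume)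
    (l := toZero) _ (Eventually.of_forall fun ε =>
      (((V.2.smooth ε).continuous.aestronglyMeasurable.sub hw.aestronglyMeasurable).mul
        cφ.aestronglyMeasurable)) ?_ i1 ?_
  · simpa using this
  · filter_upwards [hC, hC'] with ε h h'
    refine Eventually.of_forall fun t => ?_
    rw [Real.norm_eq_abs, sub_mul]
    refine (abs_sub _ _).trans ?_
    gcongr
    rw [abs_mul]
    by_cases ht : t ∈ tsupport φ
    · gcongr
      rw [sub]
      have := h' t ht
      rw [pow_zero, mul_one] at this
      exact (abs_add_le _ _).trans (add_le_add this (h t ht))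
    · simp [image_eq_zero_of_notMem_tsupport ht]
  · have : ∀ᵐ s : ℝ ∂volume, s ≠ 0 := by simp [ae_iff]
    filter_upwards [this] with t ht
    obtain ⟨B, hB⟩ := hVU.order_zero (isCompact_singleton (x := t)) 1
    have n0 : Tendsto (fun ε => (V - U).1 ε t) toZero (𝓝 0) := by
      refine squeeze_zero_norm' (a := fun ε : Eps => B * (ε : ℝ)) ?_ ?_
      · filter_upwards [hB] with ε hB
        simpa using hB t rfl
      · simpa using tendsto_eps.const_mul B
    have := ((n0.add (h t ht)).sub_const (w t)).mul_const (φ t)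
    simp only [zero_add, sub_self, zero_mul] at this
    exact this.congr fun ε => by rw [sub]

/-! ### The transversal part of the geodesic -/

/-- A net of solutions, for small `ε`, of the transversal part of the geodesic equation. -/
structure IsGeodesicNet (f : (Fin 2 → ℝ) → ℝ) (ρ : Eps → ℝ → ℝ) (x₀ x₁ : Fin 2 → ℝ)
    (X : Fin 2 → Eps → ℝ → ℝ) (Y : ℝ) : Prop where
  smooth : ∀ i ε, ContDiff ℝ ∞ (X i ε)
  init : ∀ᶠ ε in toZero, ∀ i, X i ε (-1) = x₀ i
  init' : ∀ᶠ ε in toZero, ∀ i, deriv (X i ε) (-1) = x₁ i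
  eqn : ∀ᶠ ε in toZero, ∀ i t,
    deriv (deriv (X i ε)) t = 1 / 2 * partialDeriv i f (fun j => X j ε t) * ρ ε t
  bound : ∀ᶠ ε in toZero, ∀ i t, |deriv (X i ε) t| ≤ Y
  near : ∀ᶠ ε : Eps in toZero, ∀ t ∈ Set.Icc (-(ε : ℝ)) ε,
    ‖(fun i => X i ε t) - (x₀ + x₁)‖ ≤ Y * ε

theorem exists_isGeodesicNet {f : (Fin 2 → ℝ) → ℝ} (hf : ContDiff ℝ ∞ f) {ρ : Eps → ℝ → ℝ}
    {C : ℝ} (hρ : IsDeltaNet ρ C) (x₀ x₁ : Fin 2 → ℝ) :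
    ∃ X Y, IsGeodesicNet f ρ x₀ x₁ X Y := by
  have hg : ContDiff ℝ ∞ (fun p => fun i => 1 / 2 * partialDeriv i f p : (Fin 2 → ℝ) → _) :=
    contDiff_pi.2 fun i => contDiff_const.mul (contDiff_partialDeriv hf i)
  obtain ⟨X, sX, Y, hX⟩ := exists_solution_net hg hρ.moderate.smooth hρ.eq_zero hρ.bound x₀ x₁
  have sX' : ∀ ε, ContDiff ℝ ∞ (deriv (X ε)) := fun ε => (contDiff_infty_iff_deriv.1 (sX ε)).2
  have d1 : ∀ i ε, deriv (fun t => X ε t i) = fun t => deriv (X ε) t i := fun i ε =>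
    funext fun t =>
      (hasDerivAt_pi.1 ((sX ε).differentiable (by simp) t).hasDerivAt i).deriv
  have d2 : ∀ i ε, deriv (fun t => deriv (X ε) t i) = fun t => deriv (deriv (X ε)) t i :=
    fun i ε => funext fun t =>
      (hasDerivAt_pi.1 ((sX' ε).differentiable (by simp) t).hasDerivAt i).deriv
  refine ⟨fun i ε t => X ε t i, Y, fun i ε => contDiff_pi.1 (sX ε) i, ?_, ?_, ?_, ?_, ?_⟩
  all_goals
    filter_upwards [hX] with ε ⟨h0, h1, h2, h3, h4⟩
  · simp [h0]
  · simp [d1, h1]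
  · intro i t
    simp only [d1, d2, h2]
    simp [mul_comm]
  · intro i t
    rw [d1]
    exact (norm_le_pi_norm _ i).trans (h3 t)
  · exact h4

namespace IsGeodesicNet

variable {f : (Fin 2 → ℝ) → ℝ} {ρ : Eps → ℝ → ℝ} {x₀ x₁ : Fin 2 → ℝ}
  {X : Fin 2 → Eps → ℝ → ℝ} {Y C : ℝ}

theorem hasDerivAt (h : IsGeodesicNet f ρ x₀ x₁ X Y) (i : Fin 2) (ε : Eps) (t : ℝ) :
    HasDerivAt (X i ε) (deriv (X i ε) t) t :=
  ((h.smooth i ε).differentiable (by simp) t).hasDerivAt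

theorem smooth_deriv (h : IsGeodesicNet f ρ x₀ x₁ X Y) (i : Fin 2) (ε : Eps) :
    ContDiff ℝ ∞ (deriv (X i ε)) := (contDiff_infty_iff_deriv.1 (h.smooth i ε)).2

theorem hasDerivAt_deriv (h : IsGeodesicNet f ρ x₀ x₁ X Y) (i : Fin 2) (ε : Eps) (t : ℝ) :
    HasDerivAt (deriv (X i ε)) (deriv (deriv (X i ε)) t) t :=
  ((h.smooth_deriv i ε).differentiable (by simp) t).hasDerivAt

theorem netLocallyBounded_deriv (h : IsGeodesicNet f ρ x₀ x₁ X Y) (i : Fin 2) :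
    NetLocallyBounded fun ε => deriv (X i ε) := fun _ _ => ⟨Y, by
  filter_upwards [h.bound] with ε hb t _ using hb i t⟩

theorem netLocallyBounded (h : IsGeodesicNet f ρ x₀ x₁ X Y) (i : Fin 2) :
    NetLocallyBounded (X i) := by
  intro K hK
  obtain ⟨T, hT1, hKT⟩ := exists_Icc_superset hK
  refine ⟨Y * (T + 1) + |x₀ i|, ?_⟩
  filter_upwards [h.bound, h.init] with ε hb h0 t ht
  have hY : 0 ≤ Y := (abs_nonneg _).trans (hb i t)
  have e := convex_univ.norm_image_sub_le_of_norm_hasDerivWithin_le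
      (fun s _ => (h.hasDerivAt i ε s).hasDerivWithinAt) (fun s _ => hb i s)
      (Set.mem_univ (-1)) (Set.mem_univ t)
  have e2 : ‖t - -1‖ ≤ T + 1 := by
    rw [Real.norm_eq_abs, abs_le]; constructor <;> linarith [(hKT ht).1, (hKT ht).2]
  rw [h0 i] at e
  calc |X i ε t| = |(X i ε t - x₀ i) + x₀ i| := by simp
    _ ≤ _ := abs_add_le _ _
    _ ≤ _ := by gcongr; exact e.trans (by gcongr)

theorem isModerate (h : IsGeodesicNet f ρ x₀ x₁ X Y) (hf : ContDiff ℝ ∞ f)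
    (hρ : IsModerate ρ) : ∀ i, IsModerate (X i) :=
  isModerate_of_second_order h.smooth h.netLocallyBounded h.netLocallyBounded_deriv
    (g := fun i p => 1 / 2 * partialDeriv i f p)
    (fun i => contDiff_const.mul (contDiff_partialDeriv hf i)) hρ h.eqn

theorem continuous_comp (h : IsGeodesicNet f ρ x₀ x₁ X Y) {g : (Fin 2 → ℝ) → ℝ}
    (hg : Continuous g) (ε : Eps) : Continuous fun t => g fun i => X i ε t :=
  hg.comp (continuous_pi fun i => (h.smooth i ε).continuous)

/-- Supplies the hypothesis of `IsDeltaNet.tendsto_integral_mul`, with limit value `g (x₀ + x₁)`. -/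
theorem comp_near (h : IsGeodesicNet f ρ x₀ x₁ X Y) {g : (Fin 2 → ℝ) → ℝ} (hg : Continuous g)
    {η : ℝ} (hη : 0 < η) : ∀ᶠ ε : Eps in toZero, ∀ t ∈ Set.Icc (-(ε : ℝ)) ε,
      |g (fun i => X i ε t) - g (x₀ + x₁)| ≤ η := by
  obtain ⟨δ, hδ, hgδ⟩ := Metric.continuous_iff.1 hg (x₀ + x₁) η hη
  have t1 : Tendsto (fun ε : Eps => Y * (ε : ℝ)) toZero (𝓝 0) := by
    simpa using tendsto_eps.const_mul Y
  filter_upwards [h.near, t1.eventually_lt_const hδ] with ε h1 h2 t ht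
  refine (hgδ _ ?_).le
  rw [dist_eq_norm]
  exact (h1 t ht).trans_lt h2

theorem tendsto_deriv (h : IsGeodesicNet f ρ x₀ x₁ X Y) (hf : ContDiff ℝ ∞ f)
    (hρ : IsDeltaNet ρ C) (i : Fin 2) {t : ℝ} (ht : t ≠ 0) :
    Tendsto (fun ε => deriv (X i ε) t) toZero
      (𝓝 (x₁ i + 1 / 2 * partialDeriv i f (x₀ + x₁) * heaviside t)) := by
  have hg : Continuous fun p => 1 / 2 * partialDeriv i f p :=
    continuous_const.mul (contDiff_partialDeriv hf i).continuous
  refine ((hρ.tendsto_integral_mul (h.continuous_comp hg)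
    (fun η hη => h.comp_near hg hη) ht).const_add (x₁ i)).congr' ?_
  filter_upwards [h.eqn, h.init'] with ε he h1
  have := integral_sub_of_hasDerivAt (h.hasDerivAt_deriv i ε)
    (contDiff_infty_iff_deriv.1 (h.smooth_deriv i ε)).2.continuous (-1) t
  rw [h1 i] at this
  rw [add_comm, ← eq_sub_iff_add_eq, ← this]
  refine intervalIntegral.integral_congr fun s _ => ?_
  simp only [he]
  ring

theorem tendsto (h : IsGeodesicNet f ρ x₀ x₁ X Y) (hf : ContDiff ℝ ∞ f)
    (hρ : IsDeltaNet ρ C) (i : Fin 2) (t : ℝ) :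
    Tendsto (fun ε => X i ε t) toZero
      (𝓝 (x₀ i + x₁ i * (1 + t) + 1 / 2 * partialDeriv i f (x₀ + x₁) * kink t)) := by
  rw [add_assoc]
  refine ((tendsto_integral_of_tendsto_heaviside (fun ε => (h.smooth_deriv i ε).continuous)
    (h.bound.mono fun ε hb => hb i)
    (fun t ht => h.tendsto_deriv hf hρ i ht) t).const_add (x₀ i)).congr' ?_
  filter_upwards [h.init] with ε h0
  rw [integral_sub_of_hasDerivAt (h.hasDerivAt i ε) (h.smooth_deriv i ε).continuous, h0 i]
  ring

end IsGeodesicNet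

/-! ### The longitudinal part of the geodesic -/

/-- The inhomogeneity of the once integrated equation for `v`; the term `2 ∂ᵢf ẋⁱ ρ` is
integrated by means of `∂ᵢf(x) ẋⁱ ρ = 2 ẋⁱ ẍⁱ`. -/
noncomputable def forcing (f : (Fin 2 → ℝ) → ℝ) (ρ : Eps → ℝ → ℝ) (x₁ : Fin 2 → ℝ) (X : Fin 2 → Eps → ℝ → ℝ)
    (ε : Eps) (t : ℝ) : ℝ :=
  ρ ε t * f (fun i => X i ε t) + ∑ i, (deriv (X i ε) t ^ 2 - x₁ i ^ 2)

/-- The longitudinal component of the solution. -/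
noncomputable def longitudinal (f : (Fin 2 → ℝ) → ℝ) (ρ : Eps → ℝ → ℝ) (v₀ v₁ : ℝ)
    (x₁ : Fin 2 → ℝ) (X : Fin 2 → Eps → ℝ → ℝ) (ε : Eps) (t : ℝ) : ℝ :=
  v₀ + v₁ * (1 + t) + ∫ s in (-1)..t, forcing f ρ x₁ X ε s

namespace IsGeodesicNet

variable {f : (Fin 2 → ℝ) → ℝ} {ρ : Eps → ℝ → ℝ} {x₀ x₁ : Fin 2 → ℝ}
  {X : Fin 2 → Eps → ℝ → ℝ} {Y C : ℝ}

theorem isModerate_forcing (h : IsGeodesicNet f ρ x₀ x₁ X Y) (hf : ContDiff ℝ ∞ f)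
    (hρ : IsModerate ρ) : IsModerate (forcing f ρ x₁ X) := by
  have mX := h.isModerate hf hρ
  have mf : IsModerate fun ε t => f fun i => X i ε t :=
    ⟨contDiff_comp_net hf mX, fun K hK k => moderateOn_comp mX h.netLocallyBounded hK k f hf⟩
  have m : ∀ i, IsModerate fun ε t =>
      deriv (X i ε) t * deriv (X i ε) t + -x₁ i ^ 2 := fun i =>
    ((mX i).deriv.mul (mX i).deriv).add (IsModerate.const _)
  have := (hρ.mul mf).add ((m 0).add (m 1))
  convert this using 3 with ε t
  simp only [forcing, Fin.sum_univ_two]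
  ring

theorem hasDerivAt_longitudinal (h : IsGeodesicNet f ρ x₀ x₁ X Y) (hf : ContDiff ℝ ∞ f)
    (hρ : IsModerate ρ) (v₀ v₁ : ℝ) (ε : Eps) (t : ℝ) :
    HasDerivAt (longitudinal f ρ v₀ v₁ x₁ X ε) (v₁ + forcing f ρ x₁ X ε t) t := by
  have := ((((hasDerivAt_id t).const_add 1).const_mul v₁).const_add v₀).add
    (hasDerivAt_integral ((h.isModerate_forcing hf hρ).smooth ε).continuous (-1) t)
  rw [mul_one] at this
  exact this

theorem deriv_longitudinal (h : IsGeodesicNet f ρ x₀ x₁ X Y) (hf : ContDiff ℝ ∞ f)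
    (hρ : IsModerate ρ) (v₀ v₁ : ℝ) (ε : Eps) :
    deriv (longitudinal f ρ v₀ v₁ x₁ X ε) = fun t => v₁ + forcing f ρ x₁ X ε t :=
  funext fun t => (h.hasDerivAt_longitudinal hf hρ v₀ v₁ ε t).deriv

theorem abs_sum_sq_le (hb : ∀ i t, |deriv (X i ε) t| ≤ Y) (t : ℝ) :
    |∑ i, (deriv (X i ε) t ^ 2 - x₁ i ^ 2)| ≤ ∑ i, (Y ^ 2 + x₁ i ^ 2) := by
  refine (Finset.abs_sum_le_sum_abs _ _).trans (Finset.sum_le_sum fun i _ => ?_)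
  have : deriv (X i ε) t ^ 2 ≤ Y ^ 2 := sq_le_sq' (abs_le.1 (hb i t)).1 (abs_le.1 (hb i t)).2
  rw [abs_le]
  constructor <;> nlinarith [sq_nonneg (deriv (X i ε) t), sq_nonneg (x₁ i), sq_nonneg Y]

/-- The derivative of `v_ε` may be unbounded, but its singular part `ρ f(x)` is dominated by a
constant times `|ρ|` and so is bounded in `L¹`. -/
theorem netLocallyBounded_longitudinal (h : IsGeodesicNet f ρ x₀ x₁ X Y)
    (hf : ContDiff ℝ ∞ f) (hρ : IsDeltaNet ρ C) (v₀ v₁ : ℝ) :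
    NetLocallyBounded (longitudinal f ρ v₀ v₁ x₁ X) := by
  intro K hK
  obtain ⟨T, hT1, hKT⟩ := exists_Icc_superset hK
  -- Bounds `|f(x_ε)|` on the support, by `comp_near` with tolerance 1.
  set S := |f (x₀ + x₁)| + 1 with hS
  set δ := |v₁| + ∑ i, (Y ^ 2 + x₁ i ^ 2) with hδ
  have hS0 : 0 ≤ S := by positivity
  have hδ0 : 0 ≤ δ := add_nonneg (abs_nonneg _) (Finset.sum_nonneg fun i _ => by positivity)
  refine ⟨(S * C + δ * (T + 1)) + |v₀|, ?_⟩
  filter_upwards [h.bound, h.comp_near hf.continuous one_pos, hρ.bound] with ε hb hn hC t ht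
  have dV := h.hasDerivAt_longitudinal hf hρ.moderate v₀ v₁ ε
  have cV : Continuous fun t => v₁ + forcing f ρ x₁ X ε t :=
    continuous_const.add ((h.isModerate_forcing hf hρ.moderate).smooth ε).continuous
  have cρ := (hρ.moderate.smooth ε).continuous
  have bV : ∀ s, ‖v₁ + forcing f ρ x₁ X ε s‖ ≤ S * |ρ ε s| + δ := fun s => by
    have e1 : |ρ ε s * f (fun i => X i ε s)| ≤ S * |ρ ε s| := by
      rw [abs_mul, mul_comm]
      by_cases hs : s ∈ Set.Icc (-(ε : ℝ)) ε
      · gcongr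
        have := abs_sub_abs_le_abs_sub (f fun i => X i ε s) (f (x₀ + x₁))
        linarith [hn s hs]
      · simp [hρ.eq_zero ε s hs]
    have e2 := abs_sum_sq_le (x₁ := x₁) hb s
    refine (abs_add_le _ _).trans ?_
    have e3 := abs_add_le (ρ ε s * f (fun i => X i ε s))
      (∑ i, (deriv (X i ε) s ^ 2 - x₁ i ^ 2))
    rw [forcing, hδ]
    linarith
  have iV : longitudinal f ρ v₀ v₁ x₁ X ε (-1) = v₀ := by simp [longitudinal]
  have key : |longitudinal f ρ v₀ v₁ x₁ X ε t - v₀| ≤ S * C + δ * (T + 1) := by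
    rcases le_total (-1) t with hle | hle
    · have e := norm_sub_le_of_norm_deriv_le dV cV cρ (hρ.eq_zero ε) hC hS0 hle fun s _ => bV s
      rw [iV] at e
      refine e.trans ?_
      gcongr
      linarith [(hKT ht).2]
    · have e := norm_sub_le_of_norm_deriv_le dV cV cρ (hρ.eq_zero ε) hC hS0 hle fun s _ => bV s
      rw [iV] at e
      rw [abs_sub_comm]
      refine e.trans ?_
      gcongr
      linarith [(hKT ht).1]
  calc |longitudinal f ρ v₀ v₁ x₁ X ε t|
      = |(longitudinal f ρ v₀ v₁ x₁ X ε t - v₀) + v₀| := by simp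
    _ ≤ _ := abs_add_le _ _
    _ ≤ _ := by gcongr

theorem isModerate_longitudinal (h : IsGeodesicNet f ρ x₀ x₁ X Y) (hf : ContDiff ℝ ∞ f)
    (hρ : IsDeltaNet ρ C) (v₀ v₁ : ℝ) : IsModerate (longitudinal f ρ v₀ v₁ x₁ X) := by
  have m := (IsModerate.const v₁).add (h.isModerate_forcing hf hρ.moderate)
  have e : (fun ε => deriv (longitudinal f ρ v₀ v₁ x₁ X ε)) =
      fun ε t => v₁ + forcing f ρ x₁ X ε t :=
    funext fun ε => h.deriv_longitudinal hf hρ.moderate v₀ v₁ ε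
  refine IsModerate.of_deriv (fun ε => contDiff_infty_iff_deriv.2 ⟨fun t =>
    (h.hasDerivAt_longitudinal hf hρ.moderate v₀ v₁ ε t).differentiableAt, ?_⟩)
    (fun K hK => (h.netLocallyBounded_longitudinal hf hρ v₀ v₁).moderateOn hK) (by rwa [e])
  rw [h.deriv_longitudinal hf hρ.moderate]
  exact m.smooth ε

/-- Of the two copies of `∂ᵢf(x) ẋⁱ ρ`, one comes from the product rule for `ρ f(x)`, the other from
differentiating `(ẋⁱ)²` and inserting `2ẍⁱ = ∂ᵢf(x) ρ`. -/
theorem deriv_deriv_longitudinal (h : IsGeodesicNet f ρ x₀ x₁ X Y) (hf : ContDiff ℝ ∞ f)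
    (hρ : IsModerate ρ) (v₀ v₁ : ℝ) : ∀ᶠ ε in toZero, ∀ t,
      deriv (deriv (longitudinal f ρ v₀ v₁ x₁ X ε)) t =
        f (fun i => X i ε t) * deriv (ρ ε) t + 2 * ∑ i,
          partialDeriv i f (fun j => X j ε t) * deriv (X i ε) t * ρ ε t := by
  filter_upwards [h.eqn] with ε he t
  rw [h.deriv_longitudinal hf hρ]
  have mX := h.isModerate hf hρ
  have df : HasDerivAt (fun t => f fun i => X i ε t)
      (∑ i, partialDeriv i f (fun i => X i ε t) * deriv (X i ε) t) t := by
    have := ((contDiff_comp_net hf mX ε).differentiable (by simp) t).hasDerivAt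
    rwa [deriv_comp_net hf mX ε] at this
  have dρ : HasDerivAt (ρ ε) (deriv (ρ ε) t) t :=
    ((hρ.smooth ε).differentiable (by simp) t).hasDerivAt
  have ds : HasDerivAt (fun t => ∑ i, (deriv (X i ε) t ^ 2 - x₁ i ^ 2))
      (∑ i, 2 * deriv (X i ε) t * deriv (deriv (X i ε)) t) t :=
    HasDerivAt.fun_sum fun i _ => by
      simpa using ((h.hasDerivAt_deriv i ε t).pow 2).sub_const (x₁ i ^ 2)
  have := (((dρ.mul df).add ds).const_add v₁).deriv
  refine Eq.trans this ?_
  simp only [he, Fin.sum_univ_two]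
  ring

/-- The step comes from `ρ f(x)`. The kink comes from the jump of `∑ (ẋⁱ)²`: since `θ² = θ`, `(x₁ +
½ p θ)² - x₁² = p (x₁ + ¼ p) θ` with `p = ∂ᵢf(x₀ + x₁)`. -/
theorem tendsto_longitudinal (h : IsGeodesicNet f ρ x₀ x₁ X Y) (hf : ContDiff ℝ ∞ f)
    (hρ : IsDeltaNet ρ C) (v₀ v₁ : ℝ) {t : ℝ} (ht : t ≠ 0) :
    Tendsto (fun ε => longitudinal f ρ v₀ v₁ x₁ X ε t) toZero
      (𝓝 (v₀ + v₁ * (1 + t) + f (x₀ + x₁) * heaviside t +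
        (∑ i, partialDeriv i f (x₀ + x₁) *
          (x₁ i + 1 / 4 * partialDeriv i f (x₀ + x₁))) * kink t)) := by
  have cs : ∀ ε, Continuous fun t => ∑ i, (deriv (X i ε) t ^ 2 - x₁ i ^ 2) := fun ε =>
    continuous_finsetSum _ fun i _ => ((h.smooth_deriv i ε).continuous.pow 2).sub
      continuous_const
  have l1 := hρ.tendsto_integral_mul (h.continuous_comp hf.continuous)
    (fun η hη => h.comp_near hf.continuous hη) ht
  have l2 := tendsto_integral_of_tendsto_heaviside cs
    (h.bound.mono fun ε hb => abs_sum_sq_le (x₁ := x₁) hb) (a := 0)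
    (b := ∑ i, partialDeriv i f (x₀ + x₁) * (x₁ i + 1 / 4 * partialDeriv i f (x₀ + x₁)))
    (fun t ht => by
      rw [zero_add, Finset.sum_mul]
      refine tendsto_finsetSum _ fun i _ => ?_
      have := ((h.tendsto_deriv hf hρ i ht).pow 2).sub_const (x₁ i ^ 2)
      convert this using 2
      have e := heaviside_mul_self t
      linear_combination (-(1 / 4) * partialDeriv i f (x₀ + x₁) ^ 2) * e) t
  have := (l1.add l2).const_add (v₀ + v₁ * (1 + t))
  rw [zero_mul, zero_add, ← add_assoc] at this
  refine this.congr fun ε => ?_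
  rw [longitudinal, ← intervalIntegral.integral_add]
  · rfl
  · exact ((hρ.moderate.smooth ε).continuous.mul
      (h.continuous_comp hf.continuous ε)).intervalIntegrable _ _
  · exact (cs ε).intervalIntegrable _ _

end IsGeodesicNet

/-- The geodesic net defines a solution in the Colombeau algebra. -/
theorem isLocallyBoundedGeodesic_of_net {f : (Fin 2 → ℝ) → ℝ} (hf : ContDiff ℝ ∞ f)
    {R : moderateNets} {C : ℝ} (hR : IsDeltaNet R.1 C) {x₀ x₁ : Fin 2 → ℝ}
    {X : Fin 2 → moderateNets} {Y : ℝ}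
    (h : IsGeodesicNet f R.1 x₀ x₁ (fun i => (X i).1) Y) (v₀ v₁ : ℝ) {V : moderateNets}
    (hV : V.1 = longitudinal f R.1 v₀ v₁ x₁ fun i => (X i).1) :
    IsLocallyBoundedGeodesic f hf (mk R) v₀ v₁ x₀ x₁ (mk V) fun i => mk (X i) := by
  have bX := h.netLocallyBounded
  have bV : NetLocallyBounded V.1 := by
    rw [hV]; exact h.netLocallyBounded_longitudinal hf hR v₀ v₁
  have hx : ∀ i, LocallyBounded (mk (X i)) := fun i => ⟨X i, rfl, bX i⟩
  refine ⟨⟨V, rfl, bV⟩, hx, ?_, fun i => ?_, ?_, ?_, fun i => ?_, fun i => ?_⟩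
  -- Writing the factor 2 and the sum over `i` as explicit sums exhibits the right hand side as the
  -- class of one net.
  · simp only [comp_eq_mk _ hx X bX fun _ => rfl, D_mk, Fin.sum_univ_two, two_mul]
    refine mk_eq_mk_of_eventually_eq (V := compNet f hf X bX * derivNet R +
      ((compNet _ (contDiff_partialDeriv hf 0) X bX * derivNet (X 0) * R +
        compNet _ (contDiff_partialDeriv hf 1) X bX * derivNet (X 1) * R) +
      (compNet _ (contDiff_partialDeriv hf 0) X bX * derivNet (X 0) * R +
        compNet _ (contDiff_partialDeriv hf 1) X bX * derivNet (X 1) * R))) ?_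
    filter_upwards [h.deriv_deriv_longitudinal hf hR.moderate v₀ v₁] with ε he
    funext t
    have := he t
    rw [← hV, Fin.sum_univ_two, two_mul] at this
    exact this
  · rw [comp_eq_mk _ hx X bX fun _ => rfl, D_mk, D_mk]
    refine mk_eq_mk_of_eventually_eq (V := (1 / 2 : ℝ) •
      (compNet _ (contDiff_partialDeriv hf i) X bX * R)) ?_
    filter_upwards [h.eqn] with ε he
    funext t
    exact (he i t).trans (mul_assoc _ _ _)
  · refine hasValueAt_mk_of_eventually_eq (Eventually.of_forall fun ε => ?_)
    simp [hV, longitudinal]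
  · rw [D_mk]
    refine hasValueAt_mk_of_eventually_eq ?_
    filter_upwards [h.init'] with ε h1
    change deriv (V.1 ε) (-1) = v₁
    rw [hV, h.deriv_longitudinal hf hR.moderate]
    simp only [forcing]
    -- The initial point lies before the support because `ε < 1`.
    rw [hR.eq_zero ε (-1) fun hm => by linarith [hm.1, ε.2.2]]
    simp [h1]
  · exact hasValueAt_mk_of_eventually_eq (h.init.mono fun ε h0 => h0 i)
  · rw [D_mk]
    exact hasValueAt_mk_of_eventually_eq (h.init'.mono fun ε h1 => h1 i)

end Colombeau

/-! ### The main theorem -/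

theorem theorem1 (f : (Fin 2 → ℝ) → ℝ) (hf : ContDiff ℝ ∞ f)
    (ρ : ColombeauAlgebra) (hρ : Colombeau.IsGeneralizedDelta ρ)
    (v₀ v₁ : ℝ) (x₀ x₁ : Fin 2 → ℝ) :
    (∃! s : ColombeauAlgebra × (Fin 2 → ColombeauAlgebra),
      IsLocallyBoundedGeodesic f hf ρ v₀ v₁ x₀ x₁ s.1 s.2) ∧
    ∀ (v : ColombeauAlgebra) (x : Fin 2 → ColombeauAlgebra),
      IsLocallyBoundedGeodesic f hf ρ v₀ v₁ x₀ x₁ v x →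
        (∀ i, Colombeau.Associated (x i) fun u =>
          x₀ i + x₁ i * (1 + u) + 1 / 2 * Colombeau.partialDeriv i f (x₀ + x₁) * kink u) ∧
        Colombeau.Associated v fun u =>
          v₀ + v₁ * (1 + u) + f (x₀ + x₁) * heaviside u +
            (∑ i, Colombeau.partialDeriv i f (x₀ + x₁) *
              (x₁ i + 1 / 4 * Colombeau.partialDeriv i f (x₀ + x₁))) * kink u := by
  obtain ⟨R, C, rfl, hR⟩ := Colombeau.IsGeneralizedDelta.exists_isDeltaNet hρ
  obtain ⟨X, Y, hX⟩ := Colombeau.exists_isGeodesicNet hf hR x₀ x₁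
  let X' : Fin 2 → Colombeau.moderateNets := fun i => ⟨X i, hX.isModerate hf hR.moderate i⟩
  let V : Colombeau.moderateNets := ⟨_, hX.isModerate_longitudinal hf hR v₀ v₁⟩
  have sol := Colombeau.isLocallyBoundedGeodesic_of_net hf hR (X := X') hX v₀ v₁
    (V := V) rfl
  refine ⟨⟨(Colombeau.mk V, fun i => Colombeau.mk (X' i)), sol, fun s hs => ?_⟩,
    fun v x hvx => ?_⟩
  · obtain ⟨h1, h2⟩ := Colombeau.locallyBoundedGeodesic_unique hρ hs sol
    exact Prod.ext h1 h2
  -- By uniqueness, the given solution is the constructed one, whose limits are known.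
  · obtain ⟨rfl, rfl⟩ := Colombeau.locallyBoundedGeodesic_unique hρ hvx sol
    have ca : Continuous fun u : ℝ => 1 + u := continuous_const.add continuous_id
    refine ⟨fun i => Colombeau.associated_of_tendsto (hX.netLocallyBounded i) ?_
      fun t _ => hX.tendsto hf hR i t, Colombeau.associated_of_tendsto
        (hX.netLocallyBounded_longitudinal hf hR v₀ v₁) ?_
        fun t ht => hX.tendsto_longitudinal hf hR v₀ v₁ ht⟩
    · exact ((continuous_const.add (continuous_const.mul ca)).add
        (continuous_const.mul Colombeau.continuous_kink)).locallyIntegrable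
    · exact (((continuous_const.add (continuous_const.mul ca)).locallyIntegrable).add
        (Colombeau.locallyIntegrable_heaviside.smul (f (x₀ + x₁)))).add
        (continuous_const.mul Colombeau.continuous_kink).locallyIntegrable
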